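/- Let $n\ge 1$, let $\Theta=(\Theta^{\mu\nu})_{0\le\mu,\nu\le n-1}$ be a real skew-symmetric matrix, and let $\star$ be the Moyal product $$(f\star h)(x)=\frac1{(2\pi)^n}\int\!\!\int f\bigl(x-\tfrac12\Theta u\bigr)\,h(x+v)\,e^{-iu\cdot v}\,d^nv\,d^nu$$ (iterated integral over $v$ first, for $h$ Schwartz and $f$ continuous of polynomial growth). Let $\gamma^0,\dots,\gamma^{n-1}$ be $2^{\lfloor n/2\rfloor}\times 2^{\lfloor n/2\rfloor}$ Dirac matrices of signature $(-,+,\dots,+)$, that is, $\gamma^\mu\gamma^\nu+\gamma^\nu\gamma^\mu=2\eta^{\mu\nu}$ with $\gamma^0$ anti-Hermitian and $\gamma^1,\dots,\gamma^{n-1}$ Hermitian. The Moyal–Minkowski temporal Lorentzian spectral triple $(\mathcal A,\widetilde{\mathcal A},\mathcal H,D,\mathcal T)$ consists of the Hilbert space $\mathcal H=L^2(\mathbb R^{1,n-1})\otimes\mathbb C^{2^{\lfloor n/2\rfloor}}$; the algebra $\mathcal A=(\mathcal S(\mathbb R^{1,n-1}),\star)$ of Schwartz functions and its unitization $\widetilde{\mathcal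 A}=(\mathcal B(\mathbb R^{1,n-1}),\star)$, where $\mathcal B$ is the space of smooth functions bounded together with all their derivatives, both acting on $\mathcal H$ by left Moyal multiplication $\psi\mapsto a\star\psi$ (extended continuously from Schwartz spinors); the Dirac operator $D=-i\,\partial_\mu\otimes\gamma^\mu$; and the time operator $\mathcal T=x^0$, acting by $\psi\mapsto x^0\star\psi$. Here $D$ and $\mathcal T$ are the closures of these operators on Schwartz spinors. The triple is said to have commutative time if the self-adjoint operator $S=(1+\mathcal T^2)^{1/2}$ and the commutator $[D,S]$ (the closure of $DS-SD$ on its natural domain) commute with every $a\in\widetilde{\mathcal A}$, where a bounded operator $a$ commutes with an unbounded operator $X$ if $a$ maps $\mathrm{Dom}\,X$ into itself and $aX\psi=Xa\psi$ for all $\psi\in\mathrm{Dom}\,X$. Then the Moyal–Minkowski triple has commutative time if and only if $$\Theta^{0\mu}=\Theta^{\mu0}=0\qquad\text{for all }\mu=0,\dots,n-1 .$$ -/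

import Mathlib

open MeasureTheory
open scoped SchwartzMap ContDiff Matrix

noncomputable section

/-! ## Unbounded operators on a Hilbert space -/

section Operators

variable {H : Type*} [NormedAddCommGroup H] [InnerProductSpace ℂ H]

/-- The composition `X Y` of two unbounded operators, on its natural domain
`{x ∈ Dom Y | Y x ∈ Dom X}`. -/
def opMul (X Y : H →ₗ.[ℂ] H) : H →ₗ.[ℂ] H where
  domain := (X.domain.comap Y.toFun).map Y.domain.subtype
  toFun :=
    { toFun := fun x => X ⟨Y ⟨x, by
          obtain ⟨y, -, h⟩ := x.2
          exact h ▸ y.2⟩, by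
          obtain ⟨x, y, hy, rfl⟩ := x
          exact hy⟩
      map_add' := fun x y => by
        rw [← X.map_add]
        congr 1
        apply Subtype.ext
        exact Y.map_add ⟨x, _⟩ ⟨y, _⟩
      map_smul' := fun c x => by
        rw [RingHom.id_apply, ← X.map_smul]
        congr 1
        apply Subtype.ext
        exact Y.map_smul c ⟨x, _⟩ }

theorem mem_opMul_domain {X Y : H →ₗ.[ℂ] H} {x : H} :
    x ∈ (opMul X Y).domain ↔ ∃ h : x ∈ Y.domain, Y ⟨x, h⟩ ∈ X.domain := by
  constructor
  · rintro ⟨y, hy, rfl⟩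
    exact ⟨y.2, hy⟩
  · rintro ⟨h, hx⟩
    exact ⟨⟨x, h⟩, hx, rfl⟩

theorem opMul_apply {X Y : H →ₗ.[ℂ] H} {x : H} (h : x ∈ Y.domain)
    (h' : Y ⟨x, h⟩ ∈ X.domain) :
    opMul X Y ⟨x, mem_opMul_domain.2 ⟨h, h'⟩⟩ = X ⟨Y ⟨x, h⟩, h'⟩ := rfl

/-- The commutator `[X, Y]`: the closure of `X Y - Y X`, the latter being defined on
`Dom (X Y) ∩ Dom (Y X)`. -/
def opCommutator (X Y : H →ₗ.[ℂ] H) : H →ₗ.[ℂ] H :=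
  (opMul X Y - opMul Y X).closure

/-- A bounded operator `a` commutes with an unbounded operator `X` when `a X ⊆ X a`: it maps
`Dom X` to itself, and `X a x = a X x` for all `x ∈ Dom X`. -/
def CommutesWith (a : H →L[ℂ] H) (X : H →ₗ.[ℂ] H) : Prop :=
  ∀ x : X.domain, ∃ h : a x ∈ X.domain, X ⟨a x, h⟩ = a (X x)

/-- `S = (1 + T ^ 2) ^ (1 / 2)`: the operator `S` is self-adjoint, nonnegative, and
`S ^ 2 = 1 + T ^ 2` as unbounded operators (equality of domains included). When `T` is
self-adjoint there is exactly one such `S`. -/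
structure IsSqrtOneAddSq [CompleteSpace H] (T S : H →ₗ.[ℂ] H) : Prop where
  selfAdjoint : IsSelfAdjoint S
  nonneg : ∀ x : S.domain, 0 ≤ (inner ℂ (x : H) (S x)).re
  sq_eq : opMul S S = (LinearMap.id : H →ₗ[ℂ] H) +ᵥ opMul T T

end Operators

/-- The data `(𝒜, 𝒜~, H, D, T)` of a temporal Lorentzian spectral triple; the two algebras are
given by the bounded operators on `H` that represent their elements. -/
structure TemporalTriple (H : Type*) [NormedAddCommGroup H] [InnerProductSpace ℂ H] where
  /-- the nonunital algebra -/
  algebra : Set (H →L[ℂ] H)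
  /-- its preferred unitization -/
  unitization : Set (H →L[ℂ] H)
  /-- the Dirac operator -/
  dirac : H →ₗ.[ℂ] H
  /-- the global time -/
  time : H →ₗ.[ℂ] H

/-- Commutative time: `(1 + T ^ 2) ^ (1 / 2)` and `[D, (1 + T ^ 2) ^ (1 / 2)]` commute with all
elements of the unitization. -/
def TemporalTriple.HasCommutativeTime {H : Type*} [NormedAddCommGroup H]
    [InnerProductSpace ℂ H] [CompleteSpace H] (t : TemporalTriple H) : Prop :=
  ∃ S : H →ₗ.[ℂ] H, IsSqrtOneAddSq t.time S ∧
    ∀ a ∈ t.unitization, CommutesWith a S ∧ CommutesWith a (opCommutator t.dirac S)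

/-! ## The Moyal–Minkowski spacetime -/

section Moyal

variable {n : ℕ}

/-- The coordinate space of the Minkowski spacetime `ℝ^{1,n-1}`; the Minkowski density is the
Lebesgue measure. -/
abbrev MinkowskiSpace (n : ℕ) : Type := EuclideanSpace ℝ (Fin n)

/-- The fibre `ℂ^(2^⌊n/2⌋)` of the spinor bundle. -/
abbrev SpinorFibre (n : ℕ) : Type := EuclideanSpace ℂ (Fin (2 ^ (n / 2)))

/-- The Hilbert space `L²(ℝ^{1,n-1}) ⊗ ℂ^(2^⌊n/2⌋)` of square integrable spinors. -/
abbrev SpinorL2 (n : ℕ) : Type := Lp (SpinorFibre n) 2 (volume : Measure (MinkowskiSpace n))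

/-- Schwartz spinors. -/
abbrev SpinorSchwartz (n : ℕ) : Type := 𝓢(MinkowskiSpace n, SpinorFibre n)

/-- The (spinor-componentwise) Moyal product
`(f ⋆ h)(x) = (2π)⁻ⁿ ∫ ∫ f(x - Θu/2) h(x + v) e^{-i u·v} dⁿv dⁿu`, the integral over `v` being
taken first. For `h` Schwartz that inner integral is a Schwartz function of `u`, so the iterated
integral converges absolutely for every continuous `f` of polynomial growth. -/
def moyalProd (Θ : Matrix (Fin n) (Fin n) ℝ) (f : MinkowskiSpace n → ℂ)
    (h : MinkowskiSpace n → SpinorFibre n) (x : MinkowskiSpace n) : SpinorFibre n :=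
  (((2 * Real.pi) ^ n)⁻¹ : ℝ) • ∫ u : MinkowskiSpace n,
    f (x - (1 / 2 : ℝ) • Matrix.toEuclideanLin Θ u) •
      ∫ v : MinkowskiSpace n, Complex.exp (-(Complex.I * (inner ℝ u v : ℝ))) • h (x + v)

/-- The closure in `L²` of an operator given on the Schwartz spinors: its graph is the closure of
`{(ψ, op ψ) | ψ Schwartz, op ψ ∈ L²}` (for a linear `op` that set is a subspace, and the span
below changes nothing). -/
def closureOfSchwartzOp (op : SpinorSchwartz n → MinkowskiSpace n → SpinorFibre n) :
    SpinorL2 n →ₗ.[ℂ] SpinorL2 n :=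
  (Submodule.span ℂ {p : SpinorL2 n × SpinorL2 n |
    ∃ ψ : SpinorSchwartz n, p.1 = ψ.toLp 2 volume ∧
      (p.2 : MinkowskiSpace n → SpinorFibre n) =ᵐ[volume] op ψ}).topologicalClosure.toLinearPMap

/-- The bounded operator `A` is `π(f) = L(f) ⊗ 1`, that is, the continuous extension to `L²` of
left Moyal multiplication by `f` on the Schwartz spinors. -/
def IsLeftMoyal (Θ : Matrix (Fin n) (Fin n) ℝ) (f : MinkowskiSpace n → ℂ)
    (A : SpinorL2 n →L[ℂ] SpinorL2 n) : Prop :=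
  ∀ ψ : SpinorSchwartz n,
    (A (ψ.toLp 2 volume) : MinkowskiSpace n → SpinorFibre n) =ᵐ[volume] moyalProd Θ f ψ

/-- The space `ℬ` of smooth functions that are bounded together with all their derivatives. -/
def IsSmoothBounded (f : MinkowskiSpace n → ℂ) : Prop :=
  ContDiff ℝ ∞ f ∧ ∀ k : ℕ, ∃ C : ℝ, ∀ x, ‖iteratedFDeriv ℝ k f x‖ ≤ C

/-- The flat Dirac matrices `γ⁰, …, γ^{n-1}` of signature `(-,+,…,+)`: they satisfy the Clifford
relations, `γ⁰` is anti-Hermitian and the others are Hermitian. -/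
structure IsDiracMatrices [NeZero n]
    (γ : Fin n → Matrix (Fin (2 ^ (n / 2))) (Fin (2 ^ (n / 2))) ℂ) : Prop where
  time_sq : γ 0 * γ 0 = -1
  space_sq : ∀ μ, μ ≠ 0 → γ μ * γ μ = 1
  anticomm : ∀ μ ν, μ ≠ ν → γ μ * γ ν + γ ν * γ μ = 0
  time_antiHermitian : (γ 0)ᴴ = -γ 0
  space_hermitian : ∀ μ, μ ≠ 0 → (γ μ)ᴴ = γ μ

/-- The Dirac operator `-i ∂_μ ⊗ γ^μ` on Schwartz spinors. -/
def flatDirac (γ : Fin n → Matrix (Fin (2 ^ (n / 2))) (Fin (2 ^ (n / 2))) ℂ)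
    (ψ : SpinorSchwartz n) (x : MinkowskiSpace n) : SpinorFibre n :=
  -Complex.I • ∑ μ, Matrix.toEuclideanLin (γ μ) (fderiv ℝ ψ x (EuclideanSpace.single μ 1))

/-- The Moyal–Minkowski triple `((𝓢, ⋆), (ℬ, ⋆), L² ⊗ ℂ^(2^⌊n/2⌋), -i ∂_μ ⊗ γ^μ, x⁰)`. All
functions, the unbounded coordinate function `x⁰` included, act by left Moyal multiplication. -/
def moyalMinkowski [NeZero n] (Θ : Matrix (Fin n) (Fin n) ℝ)
    (γ : Fin n → Matrix (Fin (2 ^ (n / 2))) (Fin (2 ^ (n / 2))) ℂ) :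
    TemporalTriple (SpinorL2 n) where
  algebra := {A | ∃ f : 𝓢(MinkowskiSpace n, ℂ), IsLeftMoyal Θ f A}
  unitization := {A | ∃ f : MinkowskiSpace n → ℂ, IsSmoothBounded f ∧ IsLeftMoyal Θ f A}
  dirac := closureOfSchwartzOp (flatDirac γ)
  time := closureOfSchwartzOp fun ψ => moyalProd Θ (fun x => ((x 0 : ℝ) : ℂ)) ψ

end Moyal

end

open Filter Topology
open scoped BoundedContinuousFunction LineDeriv FourierTransform

/-! ## Graphs of unbounded operators -/

section Operators

variable {H : Type*} [NormedAddCommGroup H] [InnerProductSpace ℂ H]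

/-! Write `θ` for row 0 of `Θ`. On Schwartz spinors the time operator is T = x⁰ + (i/2) ∂_θ
(`moyalProd_timeCoord`), and left Moyal multiplication U_k by the plane wave e^{i⟨k,x⟩} is a
translation by Θk/2 followed by multiplication by the wave (`moyalProd_planeWave`). Both follow from
Fourier inversion.

Necessity. A direct computation gives T U_k = U_k (T - c) with c = ⟨k, θ⟩
(`timeSchwartz_planeWave`). Plane waves lie in ℬ, so commutative time makes U_k commute with S,
hence with S² = 1 + T² and with T². Therefore (T - c)² = T², that is, 2cT = c² on Schwartz spinors.
Comparing k = θ with k = 2θ eliminates T and leaves |θ|⁴ = 0. The commutator [D, S] plays no part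
here.

Sufficiency. If row and column 0 of `Θ` vanish, T is the maximal multiplication operator by x⁰
(`closureOfSchwartzOp_eq_mulOp`), and S is multiplication by (1 + (x⁰)²)^{1/2}. A shift of the
variable u shows that left Moyal multiplication commutes with plane waves in the time direction,
because `Θ` kills that direction (`moyalProd_smul_planeWave`). Fourier inversion extends this to
Schwartz functions of time and a cutoff to all smooth ones (`commutesWith_mulOp_time`), in
particular to S. The closure of DS - SD is the bounded operator -i γ⁰ x⁰ (1 + (x⁰)²)^{-1/2}
(`eq_commOp_of_mem_graph`), a function of time times a constant matrix; the Moyal product acts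
componentwise, so it commutes with both factors.

Unbounded operators are handled through their graphs, and their values are identified by pairing
with Schwartz spinors. -/

theorem LinearPMap.apply_eq_of_mem_graph {X : H →ₗ.[ℂ] H} {x y : H} (h : (x, y) ∈ X.graph)
    (hx : x ∈ X.domain) : X ⟨x, hx⟩ = y :=
  X.mem_graph_snd_inj (X.mem_graph ⟨x, hx⟩) h rfl

theorem mem_graph_opMul {X Y : H →ₗ.[ℂ] H} {x z : H} :
    (x, z) ∈ (opMul X Y).graph ↔ ∃ y, (x, y) ∈ Y.graph ∧ (y, z) ∈ X.graph := by
  constructor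
  · intro h
    obtain ⟨hx, hy⟩ := mem_opMul_domain.1 (LinearPMap.mem_domain_of_mem_graph h)
    refine ⟨Y ⟨x, hx⟩, Y.mem_graph ⟨x, hx⟩, ?_⟩
    have := LinearPMap.apply_eq_of_mem_graph h (mem_opMul_domain.2 ⟨hx, hy⟩)
    rw [opMul_apply hx hy] at this
    exact this ▸ X.mem_graph ⟨_, hy⟩
  · rintro ⟨y, hxy, hyz⟩
    have hx := LinearPMap.mem_domain_of_mem_graph hxy
    have hy := LinearPMap.mem_domain_of_mem_graph hyz
    have e := LinearPMap.apply_eq_of_mem_graph hxy hx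
    subst e
    have := (opMul X Y).mem_graph ⟨x, mem_opMul_domain.2 ⟨hx, hy⟩⟩
    rwa [opMul_apply hx hy, LinearPMap.apply_eq_of_mem_graph hyz hy] at this

theorem mem_graph_id_vadd {X : H →ₗ.[ℂ] H} {x z : H} :
    (x, z) ∈ ((LinearMap.id : H →ₗ[ℂ] H) +ᵥ X).graph ↔ (x, z - x) ∈ X.graph := by
  constructor
  · intro h
    have hx : x ∈ ((LinearMap.id : H →ₗ[ℂ] H) +ᵥ X).domain :=
      LinearPMap.mem_domain_of_mem_graph h
    have := LinearPMap.apply_eq_of_mem_graph h hx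
    rw [LinearPMap.vadd_apply] at this
    have e : z - x = X ⟨x, hx⟩ := by rw [← this]; simp
    rw [e]
    exact X.mem_graph ⟨x, hx⟩
  · intro h
    have hx : x ∈ X.domain := LinearPMap.mem_domain_of_mem_graph h
    have := ((LinearMap.id : H →ₗ[ℂ] H) +ᵥ X).mem_graph ⟨x, hx⟩
    rw [LinearPMap.vadd_apply, LinearPMap.apply_eq_of_mem_graph h hx] at this
    simpa using this

theorem mem_graph_sub {X Y : H →ₗ.[ℂ] H} {x z : H} :
    (x, z) ∈ (X - Y).graph ↔ ∃ y y', (x, y) ∈ X.graph ∧ (x, y') ∈ Y.graph ∧ z = y - y' := by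
  constructor
  · intro h
    have hx := LinearPMap.mem_domain_of_mem_graph h
    have := LinearPMap.apply_eq_of_mem_graph h hx
    rw [LinearPMap.sub_apply] at this
    exact ⟨_, _, X.mem_graph ⟨x, hx.1⟩, Y.mem_graph ⟨x, hx.2⟩, this.symm⟩
  · rintro ⟨y, y', hy, hy', rfl⟩
    have hx : x ∈ X.domain ⊓ Y.domain :=
      ⟨LinearPMap.mem_domain_of_mem_graph hy, LinearPMap.mem_domain_of_mem_graph hy'⟩
    have := (X - Y).mem_graph ⟨x, hx⟩
    rwa [LinearPMap.sub_apply, LinearPMap.apply_eq_of_mem_graph hy,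
      LinearPMap.apply_eq_of_mem_graph hy'] at this

/-- Stability of the graph under `a × a` carries no domain proofs, so it passes easily through
compositions, sums and closures. -/
theorem commutesWith_iff {a : H →L[ℂ] H} {X : H →ₗ.[ℂ] H} :
    CommutesWith a X ↔ ∀ x y, (x, y) ∈ X.graph → (a x, a y) ∈ X.graph := by
  constructor
  · intro h x y hxy
    have hx := LinearPMap.mem_domain_of_mem_graph hxy
    obtain ⟨h1, h2⟩ := h ⟨x, hx⟩
    rw [LinearPMap.apply_eq_of_mem_graph hxy hx] at h2
    exact h2 ▸ X.mem_graph ⟨_, h1⟩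
  · intro h x
    have := h _ _ (X.mem_graph x)
    exact ⟨LinearPMap.mem_domain_of_mem_graph this, LinearPMap.apply_eq_of_mem_graph this _⟩

/-- An operator that commutes with `S` commutes with `S ^ 2`. -/
theorem CommutesWith.opMul_self {a : H →L[ℂ] H} {S : H →ₗ.[ℂ] H} (h : CommutesWith a S) :
    CommutesWith a (opMul S S) := by
  rw [commutesWith_iff] at h ⊢
  intro x z hxz
  obtain ⟨y, hy, hz⟩ := mem_graph_opMul.1 hxz
  exact mem_graph_opMul.2 ⟨a y, h _ _ hy, h _ _ hz⟩

theorem CommutesWith.of_id_vadd {a : H →L[ℂ] H} {X : H →ₗ.[ℂ] H}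
    (h : CommutesWith a ((LinearMap.id : H →ₗ[ℂ] H) +ᵥ X)) : CommutesWith a X := by
  rw [commutesWith_iff] at h ⊢
  intro x y hxy
  have := h x (y + x) (mem_graph_id_vadd.2 (by simpa using hxy))
  simpa using mem_graph_id_vadd.1 this

/-- If a densely defined operator is contained in a bounded operator `B`, and if `B` commutes with
`a`, then so does the closure. -/
theorem CommutesWith.closure_of_bounded {a B : H →L[ℂ] H} {X : H →ₗ.[ℂ] H}
    (hX : ∀ x y, (x, y) ∈ X.graph → y = B x) (hd : Dense (X.domain : Set H))
    (hc : ∀ x, a (B x) = B (a x)) : CommutesWith a X.closure := by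
  have hcl : IsClosed {p : H × H | p.2 = B p.1} :=
    isClosed_eq continuous_snd (B.continuous.comp continuous_fst)
  -- The graph of `B` is closed, so it contains the closure of the graph of `X`; single-valuedness
  -- of that closure, i.e. closability, follows.
  have hle : ∀ p ∈ X.graph.topologicalClosure, p.2 = B p.1 := fun p hp =>
    closure_minimal (s := (X.graph : Set (H × H))) (fun q hq => hX q.1 q.2 hq) hcl hp
  have hclosable : X.IsClosable := by
    refine ⟨X.graph.topologicalClosure.toLinearPMap, ?_⟩
    rw [Submodule.toLinearPMap_graph_eq]
    intro p hp h0
    rw [hle p hp, h0, map_zero]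
  -- Conversely, density of the domain and continuity of `B` put the whole graph of `B` into the
  -- closure, which is therefore everywhere defined.
  have hmem : ∀ x, (x, B x) ∈ X.graph.topologicalClosure := by
    intro x
    have hc2 : IsClosed {x : H | (x, B x) ∈ X.graph.topologicalClosure} :=
      X.graph.isClosed_topologicalClosure.preimage
        (continuous_id.prodMk B.continuous : Continuous fun x : H => (x, B x))
    refine hc2.closure_subset_iff.2 (fun y hy => ?_) (hd x)
    have hy' := X.mem_graph ⟨y, hy⟩
    rw [hX _ _ hy'] at hy'
    exact X.graph.le_topologicalClosure hy'
  rw [commutesWith_iff, ← hclosable.graph_closure_eq_closure_graph]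
  intro x y hxy
  rw [show y = B x from hle _ hxy, hc]
  exact hmem _

end Operators

/-! ## Closures of operators on Schwartz spinors -/

section SchwartzClosure

variable {n : ℕ}

/-- The class in `L²` of a Schwartz spinor. -/
noncomputable def spinorLp (ψ : SpinorSchwartz n) : SpinorL2 n := ψ.toLp 2 volume

theorem coeFn_spinorLp (ψ : SpinorSchwartz n) : spinorLp ψ =ᵐ[volume] ψ := ψ.coeFn_toLp 2 volume

theorem spinorLp_injective : Function.Injective (spinorLp (n := n)) :=
  SchwartzMap.injective_toLp 2 volume

theorem denseRange_spinorLp : DenseRange (spinorLp (n := n)) :=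
  SchwartzMap.denseRange_toLpCLM (F := SpinorFibre n) (p := 2) (by simp)

theorem inner_spinorLp (φ ψ : SpinorSchwartz n) :
    inner ℂ (spinorLp φ) (spinorLp ψ) = ∫ x, inner ℂ (φ x) (ψ x) :=
  SchwartzMap.inner_toL2_toL2_eq φ ψ volume

theorem spinorLp_add (φ ψ : SpinorSchwartz n) : spinorLp (φ + ψ) = spinorLp φ + spinorLp ψ :=
  map_add (SchwartzMap.toLpCLM ℂ (SpinorFibre n) 2 volume) φ ψ

theorem spinorLp_sub (φ ψ : SpinorSchwartz n) : spinorLp (φ - ψ) = spinorLp φ - spinorLp ψ :=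
  map_sub (SchwartzMap.toLpCLM ℂ (SpinorFibre n) 2 volume) φ ψ

theorem spinorLp_smul (c : ℂ) (ψ : SpinorSchwartz n) : spinorLp (c • ψ) = c • spinorLp ψ :=
  map_smul (SchwartzMap.toLpCLM ℂ (SpinorFibre n) 2 volume) c ψ

theorem eq_of_inner_spinorLp_eq {x y : SpinorL2 n}
    (h : ∀ φ : SpinorSchwartz n, inner ℂ (spinorLp φ) x = inner ℂ (spinorLp φ) y) : x = y := by
  have : (fun z : SpinorL2 n => inner ℂ z x) = fun z => inner ℂ z y :=
    Continuous.ext_on denseRange_spinorLp (by fun_prop) (by fun_prop)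
      (by rintro _ ⟨φ, rfl⟩; exact h φ)
  exact ext_inner_left ℂ (congrFun this)

/-- `L'` is a formal adjoint of `L` on the Schwartz spinors. -/
def IsSchwartzAdjoint (L L' : SpinorSchwartz n → SpinorSchwartz n) : Prop :=
  ∀ φ ψ, inner ℂ (spinorLp φ) (spinorLp (L ψ)) = inner ℂ (spinorLp (L' φ)) (spinorLp ψ)

variable {op : SpinorSchwartz n → MinkowskiSpace n → SpinorFibre n}
  {L L' : SpinorSchwartz n → SpinorSchwartz n}

/-- For fixed `φ` the adjoint relation is a closed linear condition on the pair `p`, so it survives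
the span and the closure in the definition of `closureOfSchwartzOp`. -/
theorem inner_eq_of_mem_closure (hop : ∀ ψ, op ψ = L ψ) (h : IsSchwartzAdjoint L L')
    {p : SpinorL2 n × SpinorL2 n}
    (hp : p ∈ (Submodule.span ℂ {p : SpinorL2 n × SpinorL2 n |
      ∃ ψ : SpinorSchwartz n, p.1 = ψ.toLp 2 volume ∧
        (p.2 : MinkowskiSpace n → SpinorFibre n) =ᵐ[volume] op ψ}).topologicalClosure)
    (φ : SpinorSchwartz n) :
    inner ℂ (spinorLp φ) p.2 = inner ℂ (spinorLp (L' φ)) p.1 := by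
  have hcl : IsClosed {p : SpinorL2 n × SpinorL2 n |
      inner ℂ (spinorLp φ) p.2 = inner ℂ (spinorLp (L' φ)) p.1} :=
    isClosed_eq (by fun_prop) (by fun_prop)
  refine closure_minimal (fun q hq => ?_) hcl hp
  induction hq using Submodule.span_induction with
  | mem q hq =>
    obtain ⟨ψ, h1, h2⟩ := hq
    have h3 : q.2 = spinorLp (L ψ) := Lp.ext (h2.trans (hop ψ ▸ (coeFn_spinorLp (L ψ)).symm))
    rw [Set.mem_ofPred_eq, h3, h1]
    exact h φ ψ
  | zero => simp
  | add a b _ _ ha hb =>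
    simp only [Set.mem_ofPred_eq, Prod.fst_add, Prod.snd_add, inner_add_right] at *
    rw [ha, hb]
  | smul c a _ ha =>
    simp only [Set.mem_ofPred_eq, Prod.smul_fst, Prod.smul_snd, inner_smul_right] at *
    rw [ha]

/-- This is closability: a formal adjoint defined on the dense space of Schwartz spinors forces `p.2
= 0` whenever `p.1 = 0`, so the closed subspace really is a graph. -/
theorem graph_closureOfSchwartzOp (hop : ∀ ψ, op ψ = L ψ) (h : IsSchwartzAdjoint L L') :
    (closureOfSchwartzOp op).graph = (Submodule.span ℂ {p : SpinorL2 n × SpinorL2 n |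
      ∃ ψ : SpinorSchwartz n, p.1 = ψ.toLp 2 volume ∧
        (p.2 : MinkowskiSpace n → SpinorFibre n) =ᵐ[volume] op ψ}).topologicalClosure := by
  refine Submodule.toLinearPMap_graph_eq _ fun p hp h0 => eq_of_inner_spinorLp_eq fun φ => ?_
  rw [inner_eq_of_mem_closure hop h hp φ, h0, inner_zero_right, inner_zero_right]

theorem inner_eq_of_mem_graph (hop : ∀ ψ, op ψ = L ψ) (h : IsSchwartzAdjoint L L')
    {x y : SpinorL2 n} (hp : (x, y) ∈ (closureOfSchwartzOp op).graph) (φ : SpinorSchwartz n) :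
    inner ℂ (spinorLp φ) y = inner ℂ (spinorLp (L' φ)) x :=
  inner_eq_of_mem_closure hop h (graph_closureOfSchwartzOp hop h ▸ hp) φ

theorem spinorLp_mem_graph (hop : ∀ ψ, op ψ = L ψ) (h : IsSchwartzAdjoint L L')
    (ψ : SpinorSchwartz n) : (spinorLp ψ, spinorLp (L ψ)) ∈ (closureOfSchwartzOp op).graph := by
  rw [graph_closureOfSchwartzOp hop h]
  exact Submodule.le_topologicalClosure _ (Submodule.subset_span
    ⟨ψ, rfl, hop ψ ▸ coeFn_spinorLp (L ψ)⟩)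

end SchwartzClosure

/-! ## Formal adjoints on Schwartz spinors -/

section SchwartzAdjoint

variable {n : ℕ} {L L' M M' : SpinorSchwartz n → SpinorSchwartz n}

theorem IsSchwartzAdjoint.comp (hL : IsSchwartzAdjoint L L') (hM : IsSchwartzAdjoint M M') :
    IsSchwartzAdjoint (fun ψ => L (M ψ)) (fun ψ => M' (L' ψ)) :=
  fun φ ψ => (hL φ (M ψ)).trans (hM (L' φ) ψ)

theorem IsSchwartzAdjoint.add (hL : IsSchwartzAdjoint L L') (hM : IsSchwartzAdjoint M M') :
    IsSchwartzAdjoint (fun ψ => L ψ + M ψ) (fun ψ => L' ψ + M' ψ) := fun φ ψ => by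
  simp only [spinorLp_add, inner_add_left, inner_add_right, hL φ ψ, hM φ ψ]

theorem IsSchwartzAdjoint.smul (c : ℂ) (hL : IsSchwartzAdjoint L L') :
    IsSchwartzAdjoint (fun ψ => c • L ψ) (fun ψ => star c • L' ψ) := fun φ ψ => by
  simp only [spinorLp_smul, inner_smul_left, inner_smul_right, hL φ ψ, starRingEnd_apply,
    star_star]

theorem IsSchwartzAdjoint.sum {ι : Type*} (s : Finset ι)
    {L L' : ι → SpinorSchwartz n → SpinorSchwartz n}
    (h : ∀ i, IsSchwartzAdjoint (L i) (L' i)) :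
    IsSchwartzAdjoint (fun ψ => ∑ i ∈ s, L i ψ) (fun ψ => ∑ i ∈ s, L' i ψ) := by
  classical
  induction s using Finset.induction_on with
  | empty =>
    intro φ ψ
    have : spinorLp (0 : SpinorSchwartz n) = 0 :=
      map_zero (SchwartzMap.toLpCLM ℂ (SpinorFibre n) 2 volume)
    simp [this]
  | insert a s ha ih =>
    simp only [Finset.sum_insert ha]
    exact (h a).add ih

theorem isSchwartzAdjoint_lineDeriv (v : MinkowskiSpace n) :
    IsSchwartzAdjoint (fun ψ : SpinorSchwartz n => ∂_{v} ψ)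
      (fun ψ => (-1 : ℂ) • ∂_{v} ψ) := fun φ ψ => by
  have h := SchwartzMap.integral_bilinear_lineDerivOp_right_eq_neg_left (μ := volume) φ ψ
    ((isBoundedBilinearMap_inner (𝕜 := ℂ) (E := SpinorFibre n)).toContinuousLinearMap) v
  rw [spinorLp_smul, inner_smul_left, inner_spinorLp, inner_spinorLp]
  simp only [map_neg, map_one, neg_mul, one_mul]
  exact h

theorem isSchwartzAdjoint_smulLeft {g : MinkowskiSpace n → ℂ} (hg : g.HasTemperateGrowth)
    (hr : ∀ x, star (g x) = g x) :
    IsSchwartzAdjoint (fun ψ : SpinorSchwartz n => SchwartzMap.smulLeftCLM (SpinorFibre n) g ψ)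
      (fun ψ => SchwartzMap.smulLeftCLM (SpinorFibre n) g ψ) := fun φ ψ => by
  simp only [inner_spinorLp, SchwartzMap.smulLeftCLM_apply_apply hg, inner_smul_left,
    inner_smul_right, starRingEnd_apply, hr]

/-- The action of a constant matrix on the fibre. -/
noncomputable abbrev fibreCLM (M : Matrix (Fin (2 ^ (n / 2))) (Fin (2 ^ (n / 2))) ℂ) :
    SpinorFibre n →L[ℂ] SpinorFibre n :=
  Matrix.toEuclideanCLM (𝕜 := ℂ) M

theorem inner_fibreCLM (M : Matrix (Fin (2 ^ (n / 2))) (Fin (2 ^ (n / 2))) ℂ)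
    (v w : SpinorFibre n) : inner ℂ v (fibreCLM M w) = inner ℂ (fibreCLM Mᴴ v) w := by
  have h : fibreCLM Mᴴ = ContinuousLinearMap.adjoint (fibreCLM M) :=
    map_star (Matrix.toEuclideanCLM (𝕜 := ℂ)) M
  rw [h, ContinuousLinearMap.adjoint_inner_left]

theorem isSchwartzAdjoint_fibre (M : Matrix (Fin (2 ^ (n / 2))) (Fin (2 ^ (n / 2))) ℂ) :
    IsSchwartzAdjoint (fun ψ : SpinorSchwartz n => ψ.postcompCLM (fibreCLM M))
      (fun ψ => ψ.postcompCLM (fibreCLM Mᴴ)) := fun φ ψ => by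
  simp only [inner_spinorLp, SchwartzMap.postcompCLM_apply, inner_fibreCLM]

theorem lineDeriv_postcompCLM (M : SpinorFibre n →L[ℂ] SpinorFibre n) (v : MinkowskiSpace n)
    (ψ : SpinorSchwartz n) :
    ∂_{v} (ψ.postcompCLM M) = (∂_{v} ψ).postcompCLM M := by
  ext1 x
  have h := ((M.restrictScalars ℝ).hasFDerivAt.comp x (ψ.hasFDerivAt x)).fderiv
  rw [SchwartzMap.postcompCLM_apply, SchwartzMap.lineDerivOp_apply_eq_fderiv,
    SchwartzMap.lineDerivOp_apply_eq_fderiv]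
  exact congrArg (fun T => T v) h

variable (γ : Fin n → Matrix (Fin (2 ^ (n / 2))) (Fin (2 ^ (n / 2))) ℂ)

/-- The Dirac operator as a map of Schwartz spinors. -/
noncomputable def diracSchwartz (ψ : SpinorSchwartz n) : SpinorSchwartz n :=
  -Complex.I • ∑ μ, (∂_{(EuclideanSpace.single μ 1 : MinkowskiSpace n)} ψ).postcompCLM
    (fibreCLM (γ μ))

theorem diracSchwartz_apply (ψ : SpinorSchwartz n) (x : MinkowskiSpace n) :
    diracSchwartz γ ψ x = -Complex.I •
      ∑ μ, fibreCLM (γ μ) (fderiv ℝ ψ x (EuclideanSpace.single μ 1)) := by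
  rw [diracSchwartz, smul_apply, sum_apply]
  rfl

theorem flatDirac_eq (ψ : SpinorSchwartz n) : flatDirac γ ψ = diracSchwartz γ ψ :=
  funext fun x => (diracSchwartz_apply γ ψ x).symm

/-- The sign from integration by parts cancels the one from conjugating -i, so only the matrices
change. The operator need not be symmetric, since γ⁰ is anti-Hermitian. -/
theorem isSchwartzAdjoint_dirac :
    IsSchwartzAdjoint (diracSchwartz γ) (diracSchwartz fun μ => (γ μ)ᴴ) := by
  have := (IsSchwartzAdjoint.sum Finset.univ fun μ => (isSchwartzAdjoint_fibre (γ μ)).comp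
    (isSchwartzAdjoint_lineDeriv (EuclideanSpace.single μ 1))).smul (-Complex.I)
  convert this using 2 with φ
  · rfl
  · simp only [diracSchwartz, lineDeriv_postcompCLM, ← Finset.smul_sum, smul_smul]
    simp

variable [NeZero n]

/-- The time coordinate, as a complex function. -/
noncomputable def timeCoord (x : MinkowskiSpace n) : ℂ := ((x 0 : ℝ) : ℂ)

theorem hasTemperateGrowth_timeCoord : (timeCoord (n := n)).HasTemperateGrowth :=
  (Complex.ofRealCLM ∘L EuclideanSpace.proj (𝕜 := ℝ) (ι := Fin n) (0 : Fin n)).hasTemperateGrowth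

/-- The operator `x⁰ + (i/2) Θ^{0μ} ∂_μ` on Schwartz spinors. -/
noncomputable def timeSchwartz (Θ : Matrix (Fin n) (Fin n) ℝ) (ψ : SpinorSchwartz n) :
    SpinorSchwartz n :=
  SchwartzMap.smulLeftCLM (SpinorFibre n) timeCoord ψ +
    (Complex.I / 2) • ∂_{(WithLp.toLp 2 (Θ 0) : MinkowskiSpace n)} ψ

theorem timeSchwartz_apply (Θ : Matrix (Fin n) (Fin n) ℝ) (ψ : SpinorSchwartz n)
    (x : MinkowskiSpace n) : timeSchwartz Θ ψ x =
      timeCoord x • ψ x + (Complex.I / 2) • fderiv ℝ ψ x (WithLp.toLp 2 (Θ 0)) := by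
  rw [timeSchwartz, add_apply,
    SchwartzMap.smulLeftCLM_apply_apply hasTemperateGrowth_timeCoord]
  rfl

/-- Symmetric because x⁰ is real and i times a derivative along a real vector is symmetric. -/
theorem isSchwartzAdjoint_time (Θ : Matrix (Fin n) (Fin n) ℝ) :
    IsSchwartzAdjoint (timeSchwartz Θ) (timeSchwartz Θ) := by
  have := (isSchwartzAdjoint_smulLeft (n := n) hasTemperateGrowth_timeCoord
    (fun x => Complex.conj_ofReal _)).add
    ((isSchwartzAdjoint_lineDeriv (WithLp.toLp 2 (Θ 0))).smul (Complex.I / 2))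
  convert this using 2 with φ
  · rfl
  · simp only [timeSchwartz, smul_smul]
    simp [neg_div]

end SchwartzAdjoint

/-! ## Multiplication operators -/

section Multiplication

variable {n : ℕ}

/-- The maximal multiplication operator by a function. -/
noncomputable def mulOp (g : MinkowskiSpace n → ℂ) : SpinorL2 n →ₗ.[ℂ] SpinorL2 n :=
  Submodule.toLinearPMap
    { carrier := {p : SpinorL2 n × SpinorL2 n | p.2 =ᵐ[volume] fun x => g x • p.1 x}
      add_mem' := fun {p q} hp hq => by
        filter_upwards [hp, hq, Lp.coeFn_add p.1 q.1, Lp.coeFn_add p.2 q.2] with x h1 h2 h3 h4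
        simp only [Prod.fst_add, Prod.snd_add, h3, h4, Pi.add_apply, h1, h2, smul_add]
      zero_mem' := by
        filter_upwards [Lp.coeFn_zero (SpinorFibre n) 2 (volume : Measure (MinkowskiSpace n))]
          with x h
        simp only [Prod.fst_zero, Prod.snd_zero, h, Pi.zero_apply, smul_zero]
      smul_mem' := fun c p hp => by
        filter_upwards [hp, Lp.coeFn_smul c p.1, Lp.coeFn_smul c p.2] with x h1 h3 h4
        simp only [Prod.smul_fst, Prod.smul_snd, h3, h4, Pi.smul_apply, h1, smul_comm c] }

theorem mem_graph_mulOp {g : MinkowskiSpace n → ℂ} {x y : SpinorL2 n} :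
    (x, y) ∈ (mulOp g).graph ↔ y =ᵐ[volume] fun t => g t • x t := by
  rw [mulOp, Submodule.toLinearPMap_graph_eq]
  · rfl
  · rintro ⟨x, y⟩ h h0
    obtain rfl : x = 0 := h0
    refine Lp.ext ?_
    filter_upwards [h, Lp.coeFn_zero (SpinorFibre n) 2 (volume : Measure (MinkowskiSpace n))]
      with t h1 h2
    rw [h1, h2, Pi.zero_apply, smul_zero]

theorem memLp_smul (g : MinkowskiSpace n →ᵇ ℂ) (ψ : SpinorL2 n) :
    MemLp (fun x => g x • ψ x) 2 volume :=
  (Lp.memLp ψ).of_le_mul (c := ‖g‖)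
    (g.continuous.aestronglyMeasurable.smul (Lp.aestronglyMeasurable ψ))
    (Eventually.of_forall fun x => by
      rw [norm_smul]; exact mul_le_mul_of_nonneg_right (g.norm_coe_le_norm x) (norm_nonneg _))

/-- Multiplication by a bounded continuous function. -/
noncomputable def mulCLM (g : MinkowskiSpace n →ᵇ ℂ) : SpinorL2 n →L[ℂ] SpinorL2 n :=
  have hm := memLp_smul g
  LinearMap.mkContinuous
    { toFun := fun ψ => (hm ψ).toLp _
      map_add' := fun φ ψ => by
        rw [← MemLp.toLp_add]
        refine MemLp.toLp_congr _ _ ?_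
        filter_upwards [Lp.coeFn_add φ ψ] with x h
        simp only [h, Pi.add_apply, smul_add]
      map_smul' := fun c ψ => by
        rw [RingHom.id_apply, ← MemLp.toLp_const_smul]
        refine MemLp.toLp_congr _ _ ?_
        filter_upwards [Lp.coeFn_smul c ψ] with x h
        simp only [h, Pi.smul_apply, smul_comm c] } ‖g‖ fun ψ => by
    refine Lp.norm_le_mul_norm_of_ae_le_mul ?_
    filter_upwards [(hm ψ).coeFn_toLp] with x h
    change ‖((hm ψ).toLp _ : MinkowskiSpace n → SpinorFibre n) x‖ ≤ _
    rw [h, norm_smul]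
    exact mul_le_mul_of_nonneg_right (g.norm_coe_le_norm x) (norm_nonneg _)

theorem coeFn_mulCLM (g : MinkowskiSpace n →ᵇ ℂ) (ψ : SpinorL2 n) :
    mulCLM g ψ =ᵐ[volume] fun x => g x • ψ x :=
  (memLp_smul g ψ).coeFn_toLp

theorem mulCLM_spinorLp (g : MinkowskiSpace n →ᵇ ℂ)
    (hg : (g : MinkowskiSpace n → ℂ).HasTemperateGrowth) (ψ : SpinorSchwartz n) :
    mulCLM g (spinorLp ψ) = spinorLp (SchwartzMap.smulLeftCLM (SpinorFibre n) g ψ) := by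
  refine Lp.ext ?_
  filter_upwards [coeFn_mulCLM g (spinorLp ψ), coeFn_spinorLp ψ,
    coeFn_spinorLp (SchwartzMap.smulLeftCLM (SpinorFibre n) g ψ)] with x h1 h2 h3
  rw [h1, h2, h3, SchwartzMap.smulLeftCLM_apply_apply hg]

/-- Multiplication by a real function is symmetric. -/
theorem inner_eq_of_ae_eq_smul {g : MinkowskiSpace n → ℂ} (hr : ∀ x, star (g x) = g x)
    {x y x' y' : SpinorL2 n} (h : y =ᵐ[volume] fun t => g t • x t)
    (h' : y' =ᵐ[volume] fun t => g t • x' t) : inner ℂ y x' = inner ℂ x y' := by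
  rw [L2.inner_def, L2.inner_def]
  refine integral_congr_ae ?_
  filter_upwards [h, h'] with t h1 h2
  rw [h1, h2, inner_smul_left, inner_smul_right, starRingEnd_apply, hr]

theorem spinorLp_mem_graph_mulOp {g : MinkowskiSpace n → ℂ} (hg : g.HasTemperateGrowth)
    (ψ : SpinorSchwartz n) :
    (spinorLp ψ, spinorLp (SchwartzMap.smulLeftCLM (SpinorFibre n) g ψ)) ∈ (mulOp g).graph := by
  rw [mem_graph_mulOp]
  filter_upwards [coeFn_spinorLp ψ,
    coeFn_spinorLp (SchwartzMap.smulLeftCLM (SpinorFibre n) g ψ)] with x h1 h2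
  rw [h1, h2, SchwartzMap.smulLeftCLM_apply_apply hg]

theorem dense_domain_mulOp {g : MinkowskiSpace n → ℂ} (hg : g.HasTemperateGrowth) :
    Dense ((mulOp g).domain : Set (SpinorL2 n)) := by
  refine Dense.mono ?_ denseRange_spinorLp
  rintro _ ⟨ψ, rfl⟩
  exact LinearPMap.mem_domain_of_mem_graph (spinorLp_mem_graph_mulOp hg ψ)

/-- Multiplication by a real function with bounded inverse is self-adjoint. -/
theorem isSelfAdjoint_mulOp {g : MinkowskiSpace n → ℂ} (hg : g.HasTemperateGrowth)
    (hr : ∀ x, star (g x) = g x) (h : MinkowskiSpace n →ᵇ ℂ) (hgh : ∀ x, g x * h x = 1) :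
    IsSelfAdjoint (mulOp g) := by
  have hd := dense_domain_mulOp hg
  have hhr : ∀ x, star (h x) = h x := fun x => by
    have e := congrArg star (hgh x)
    rw [star_mul', hr, star_one] at e
    exact mul_left_cancel₀ (left_ne_zero_of_mul_eq_one (hgh x)) (e.trans (hgh x).symm)
  rw [LinearPMap.isSelfAdjoint_def]
  refine le_antisymm (LinearPMap.le_of_le_graph ?_) (LinearPMap.IsFormalAdjoint.le_adjoint hd ?_)
  · rintro ⟨y, z⟩ hyz
    have hy := LinearPMap.mem_domain_of_mem_graph hyz
    -- Every `w` is `g` times the domain element `h w`; testing the adjoint relation on these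
    -- elements determines `y`.
    have key : y = mulCLM h z := by
      refine ext_inner_right ℂ fun w => ?_
      have hw : (mulCLM h w, w) ∈ (mulOp g).graph := by
        rw [mem_graph_mulOp]
        filter_upwards [coeFn_mulCLM h w] with x hx
        rw [hx, smul_smul, hgh, one_smul]
      have h1 := LinearPMap.adjoint_isFormalAdjoint hd ⟨y, hy⟩
        ⟨mulCLM h w, LinearPMap.mem_domain_of_mem_graph hw⟩
      rw [LinearPMap.apply_eq_of_mem_graph hyz, LinearPMap.apply_eq_of_mem_graph hw] at h1
      rw [← h1]
      exact (inner_eq_of_ae_eq_smul hhr (coeFn_mulCLM h z) (coeFn_mulCLM h w)).symm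
    rw [mem_graph_mulOp, key]
    filter_upwards [coeFn_mulCLM h z] with x hx
    rw [hx, smul_smul, hgh, one_smul]
  · intro x y
    exact inner_eq_of_ae_eq_smul hr (mem_graph_mulOp.1 ((mulOp g).mem_graph x))
      (mem_graph_mulOp.1 ((mulOp g).mem_graph y))

theorem mulOp_inner_nonneg {g : MinkowskiSpace n → ℂ} (hr : ∀ x, star (g x) = g x)
    (h0 : ∀ x, 0 ≤ (g x).re) (x : (mulOp g).domain) :
    0 ≤ (inner ℂ (x : SpinorL2 n) (mulOp g x)).re := by
  rw [L2.inner_def]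
  have := integral_re (𝕜 := ℂ) (L2.integrable_inner (𝕜 := ℂ) (x : SpinorL2 n) (mulOp g x))
  simp only [RCLike.re_eq_complex_re] at this
  rw [← this]
  refine integral_nonneg_of_ae ?_
  filter_upwards [mem_graph_mulOp.1 ((mulOp g).mem_graph x)] with t ht
  rw [ht, inner_smul_right, inner_self_eq_norm_sq_to_K]
  have : (g t).im = 0 := by
    have := congrArg Complex.im (hr t)
    simp at this
    linarith
  simp [this, ← Complex.ofReal_pow]
  exact mul_nonneg (h0 t) (by positivity)

/-- If `s ^ 2 = 1 + t ^ 2` with `1 / s` and `t / s` bounded, then `s ^ 2 = 1 + t ^ 2` holds for the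
multiplication operators. -/
theorem opMul_mulOp_self_eq {s t : MinkowskiSpace n → ℂ} (hst : ∀ x, s x ^ 2 = 1 + t x ^ 2)
    (h k : MinkowskiSpace n →ᵇ ℂ) (hh : ∀ x, s x * h x = 1) (hk : ∀ x, k x = t x * h x) :
    opMul (mulOp s) (mulOp s) =
      (LinearMap.id : SpinorL2 n →ₗ[ℂ] SpinorL2 n) +ᵥ opMul (mulOp t) (mulOp t) := by
  refine LinearPMap.eq_of_eq_graph (Submodule.ext fun ⟨x, z⟩ => ?_)
  rw [mem_graph_id_vadd, mem_graph_opMul, mem_graph_opMul]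
  simp only [mem_graph_mulOp]
  constructor
  · rintro ⟨y, hy, hz⟩
    -- The function `k` is t/s, so `t x = k (s x)` is square integrable as soon as `s x` is.
    have hy' : mulCLM k y =ᵐ[volume] fun a => t a • x a := by
      filter_upwards [coeFn_mulCLM k y, hy] with a h1 h2
      rw [h1, h2, smul_smul, hk, mul_assoc, mul_comm (h a), hh, mul_one]
    refine ⟨mulCLM k y, hy', ?_⟩
    filter_upwards [hy', hy, hz, Lp.coeFn_sub z x] with a h1 h2 h3 h4
    rw [h1, h4, Pi.sub_apply, h3, h2, smul_smul, smul_smul, ← pow_two, ← pow_two, hst, add_smul,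
      one_smul, add_sub_cancel_left]
  · rintro ⟨y, hy, hz⟩
    have hz' : z =ᵐ[volume] fun a => (s a ^ 2) • x a := by
      filter_upwards [hy, hz, Lp.coeFn_sub z x] with a h2 h3 h4
      rw [h4, Pi.sub_apply, h2, smul_smul, ← pow_two] at h3
      rw [hst, add_smul, one_smul, ← h3, add_sub_cancel]
    -- The intermediate vector `s x` is `h` times `z = s² x`, and so lies in L².
    refine ⟨mulCLM h z, ?_, ?_⟩
    · filter_upwards [coeFn_mulCLM h z, hz'] with a h1 h2
      rw [h1, h2, smul_smul, pow_two, ← mul_assoc, mul_comm (h a), hh, one_mul]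
    · filter_upwards [coeFn_mulCLM h z] with a h1
      rw [h1, smul_smul, hh, one_smul]

/-- The Schwartz spinors are a core of a multiplication operator. -/
theorem closureOfSchwartzOp_eq_mulOp {s t : MinkowskiSpace n → ℂ}
    (hst : ∀ x, s x ^ 2 = 1 + t x ^ 2) (ht : t.HasTemperateGrowth)
    (h k : MinkowskiSpace n →ᵇ ℂ) (hh : ∀ x, s x * h x = 1) (hk : ∀ x, k x = t x * h x)
    (hht : (h : MinkowskiSpace n → ℂ).HasTemperateGrowth)
    {op : SpinorSchwartz n → MinkowskiSpace n → SpinorFibre n}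
    (hop : ∀ ψ, op ψ = SchwartzMap.smulLeftCLM (SpinorFibre n) t ψ)
    (hadj : IsSchwartzAdjoint (SchwartzMap.smulLeftCLM (SpinorFibre n) t)
      (SchwartzMap.smulLeftCLM (SpinorFibre n) t)) :
    closureOfSchwartzOp op = mulOp t := by
  have hh0 : ∀ a, h a ≠ 0 := fun a => right_ne_zero_of_mul_eq_one (hh a)
  -- Multiplying `y = t x` by the nowhere vanishing `h` turns membership in the graph into an
  -- equation between bounded operators, whence closedness.
  have hiff : ∀ x y : SpinorL2 n, (x, y) ∈ (mulOp t).graph ↔ mulCLM h y = mulCLM k x := by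
    intro x y
    rw [mem_graph_mulOp]
    constructor
    · intro hy
      refine Lp.ext ?_
      filter_upwards [hy, coeFn_mulCLM h y, coeFn_mulCLM k x] with a h1 h2 h3
      rw [h2, h3, h1, smul_smul, hk, mul_comm]
    · intro e
      filter_upwards [coeFn_mulCLM h y, coeFn_mulCLM k x] with a h2 h3
      rw [e, h3, hk, mul_comm, mul_smul] at h2
      exact (smul_right_injective (SpinorFibre n) (hh0 a) h2).symm
  have hcl : IsClosed ((mulOp t).graph : Set (SpinorL2 n × SpinorL2 n)) := by
    have : ((mulOp t).graph : Set (SpinorL2 n × SpinorL2 n)) =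
        {p | mulCLM h p.2 = mulCLM k p.1} := Set.ext fun p => hiff p.1 p.2
    rw [this]
    exact isClosed_eq (by fun_prop) (by fun_prop)
  refine LinearPMap.eq_of_eq_graph (le_antisymm ?_ ?_)
  · rw [graph_closureOfSchwartzOp hop hadj]
    refine Submodule.topologicalClosure_minimal _ (Submodule.span_le.2 ?_) hcl
    rintro ⟨x, y⟩ ⟨ψ, h1, h2⟩
    obtain rfl : x = spinorLp ψ := h1
    have h3 : y = spinorLp (SchwartzMap.smulLeftCLM (SpinorFibre n) t ψ) :=
      Lp.ext (h2.trans (hop ψ ▸ (coeFn_spinorLp _).symm))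
    rw [h3]
    exact spinorLp_mem_graph_mulOp ht ψ
  · rintro ⟨x, y⟩ hxy
    rw [mem_graph_mulOp] at hxy
    -- This is `s x`, since h + k t = h (1 + t²) = h s² = s on the graph. The graph is thus the
    -- image of all of L² under the continuous map `z ↦ (h z, k z)`, and Schwartz `z` are sent into
    -- the graph of the Schwartz operator.
    set χ : SpinorL2 n := mulCLM h x + mulCLM k y with hχ
    have hχs : χ =ᵐ[volume] fun a => s a • x a := by
      filter_upwards [hxy, Lp.coeFn_add (mulCLM h x) (mulCLM k y), coeFn_mulCLM h x,
        coeFn_mulCLM k y] with a h1 h2 h3 h4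
      rw [hχ, h2, Pi.add_apply, h3, h4, h1, smul_smul, ← add_smul, hk]
      congr 1
      linear_combination s a * hh a - h a * hst a
    have hx : x = mulCLM h χ := Lp.ext <| by
      filter_upwards [hχs, coeFn_mulCLM h χ] with a h1 h2
      rw [h2, h1, smul_smul, mul_comm, hh, one_smul]
    have hy : y = mulCLM k χ := Lp.ext <| by
      filter_upwards [hχs, coeFn_mulCLM k χ, hxy] with a h1 h2 h3
      rw [h2, h1, h3, smul_smul, hk, mul_assoc, mul_comm (h a), hh, mul_one]
    have hcl2 : IsClosed {z : SpinorL2 n | (mulCLM h z, mulCLM k z) ∈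
        (closureOfSchwartzOp op).graph} := by
      rw [graph_closureOfSchwartzOp hop hadj]
      exact (Submodule.isClosed_topologicalClosure _).preimage
        ((mulCLM h).continuous.prodMk (mulCLM k).continuous)
    rw [hx, hy]
    refine hcl2.closure_subset_iff.2 ?_ (denseRange_spinorLp χ)
    rintro _ ⟨ψ, rfl⟩
    have h1 := spinorLp_mem_graph hop hadj (SchwartzMap.smulLeftCLM (SpinorFibre n) h ψ)
    rw [← mulCLM_spinorLp h hht] at h1
    suffices e : mulCLM k (spinorLp ψ) = spinorLp (SchwartzMap.smulLeftCLM (SpinorFibre n) t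
        (SchwartzMap.smulLeftCLM (SpinorFibre n) h ψ)) by
      rw [← e] at h1
      exact h1
    refine Lp.ext ?_
    filter_upwards [coeFn_mulCLM k (spinorLp ψ), coeFn_spinorLp ψ, coeFn_spinorLp
      (SchwartzMap.smulLeftCLM (SpinorFibre n) t (SchwartzMap.smulLeftCLM (SpinorFibre n) h ψ))]
      with a h2 h3 h4
    rw [h2, h3, h4, SchwartzMap.smulLeftCLM_apply_apply ht,
      SchwartzMap.smulLeftCLM_apply_apply hht, smul_smul, hk]

end Multiplication

/-! ## Plane waves -/

section PlaneWave

variable {n : ℕ}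

/-- The plane wave `x ↦ e^{i⟨a, x⟩}`. -/
noncomputable def planeWave (a x : MinkowskiSpace n) : ℂ :=
  Complex.exp (Complex.I * (inner ℝ a x : ℝ))

theorem norm_planeWave (a x : MinkowskiSpace n) : ‖planeWave a x‖ = 1 := by
  rw [planeWave, mul_comm, Complex.norm_exp_ofReal_mul_I]

theorem planeWave_add (a x y : MinkowskiSpace n) :
    planeWave a (x + y) = planeWave a x * planeWave a y := by
  simp only [planeWave, inner_add_right, Complex.ofReal_add, mul_add, Complex.exp_add]

theorem hasDerivAt_exp_I_mul (t : ℝ) :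
    HasDerivAt (fun t : ℝ => Complex.exp (Complex.I * t))
      (Complex.I * Complex.exp (Complex.I * t)) t := by
  have := ((Complex.ofRealCLM.hasDerivAt (x := t)).const_mul Complex.I).cexp
  simpa [mul_comm] using this

theorem iteratedDeriv_exp_I_mul (k : ℕ) :
    iteratedDeriv k (fun t : ℝ => Complex.exp (Complex.I * t)) =
      fun t : ℝ => Complex.I ^ k * Complex.exp (Complex.I * t) := by
  induction k with
  | zero => simp
  | succ k ih =>
    rw [iteratedDeriv_succ, ih]
    funext t
    rw [((hasDerivAt_exp_I_mul t).const_mul _).deriv, pow_succ, mul_assoc]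

/-- The wave is t ↦ e^{it}, all of whose derivatives have modulus one, composed with a linear
functional; its k-th derivative is thus bounded by the k-th power of the norm of that functional. -/
theorem isSmoothBounded_planeWave (a : MinkowskiSpace n) : IsSmoothBounded (planeWave a) := by
  have hs : ContDiff ℝ ∞ (fun t : ℝ => Complex.exp (Complex.I * t)) :=
    (contDiff_const.mul Complex.ofRealCLM.contDiff).cexp
  have he : planeWave a = (fun t : ℝ => Complex.exp (Complex.I * t)) ∘ (innerSL ℝ a) := by
    funext x
    simp [planeWave]
  refine ⟨he ▸ hs.comp (innerSL ℝ a).contDiff, fun k => ⟨∏ _i : Fin k, ‖innerSL ℝ a‖, fun x => ?_⟩⟩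
  rw [he, (innerSL ℝ a).iteratedFDeriv_comp_right hs x (mod_cast le_top)]
  refine (ContinuousMultilinearMap.norm_compContinuousLinearMap_le _ _).trans ?_
  rw [norm_iteratedFDeriv_eq_norm_iteratedDeriv, iteratedDeriv_exp_I_mul]
  rw [norm_mul, norm_pow, Complex.norm_I, one_pow, one_mul, mul_comm Complex.I,
    Complex.norm_exp_ofReal_mul_I, one_mul]

theorem IsSmoothBounded.hasTemperateGrowth {f : MinkowskiSpace n → ℂ} (hf : IsSmoothBounded f) :
    f.HasTemperateGrowth :=
  ⟨hf.1, fun k => by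
    obtain ⟨C, hC⟩ := hf.2 k
    exact ⟨0, C, fun x => by simpa using hC x⟩⟩

theorem hasTemperateGrowth_planeWave (a : MinkowskiSpace n) :
    (planeWave a).HasTemperateGrowth :=
  (isSmoothBounded_planeWave a).hasTemperateGrowth

/-- The plane wave as a bounded continuous function. -/
noncomputable def planeWaveBCF (a : MinkowskiSpace n) : MinkowskiSpace n →ᵇ ℂ :=
  BoundedContinuousFunction.ofNormedAddCommGroup (planeWave a)
    (hasTemperateGrowth_planeWave a).1.continuous 1 fun x => (norm_planeWave a x).le

theorem planeWaveBCF_apply (a x : MinkowskiSpace n) : planeWaveBCF a x = planeWave a x := rfl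

end PlaneWave

/-! ## The Moyal product -/

section MoyalProduct

variable {n : ℕ} (Θ : Matrix (Fin n) (Fin n) ℝ)

/-- The translated spinor `v ↦ h (x + v)`. -/
noncomputable def translateSchwartz (x : MinkowskiSpace n) (h : SpinorSchwartz n) :
    SpinorSchwartz n :=
  SchwartzMap.compSubConstCLM ℂ (-x) h

theorem translateSchwartz_apply (x v : MinkowskiSpace n) (h : SpinorSchwartz n) :
    translateSchwartz x h v = h (x + v) := by
  rw [translateSchwartz, SchwartzMap.compSubConstCLM_apply, sub_neg_eq_add, add_comm]

/-- The inner integral is the Fourier transform of a translate of `h`. Substituting u = 2πw absorbs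
the factor (2π)⁻ⁿ and turns Θu/2 into πΘw. Scaling invariance of the integral needs no
integrability, so `f` is arbitrary. -/
theorem moyalProd_eq_fourier (f : MinkowskiSpace n → ℂ) (h : SpinorSchwartz n)
    (x : MinkowskiSpace n) : moyalProd Θ f h x =
      ∫ w : MinkowskiSpace n, f (x - Real.pi • Matrix.toEuclideanLin Θ w) •
        (𝓕 (translateSchwartz x h)) w := by
  have hpi : (2 * Real.pi) ≠ 0 := by positivity
  have key : ∀ u : MinkowskiSpace n,
      f (x - (1 / 2 : ℝ) • Matrix.toEuclideanLin Θ u) •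
        ∫ v : MinkowskiSpace n, Complex.exp (-(Complex.I * (inner ℝ u v : ℝ))) • h (x + v) =
      (fun w : MinkowskiSpace n => f (x - Real.pi • Matrix.toEuclideanLin Θ w) •
        (𝓕 (translateSchwartz x h)) w) ((2 * Real.pi)⁻¹ • u) := fun u => by
    simp only
    rw [map_smul, smul_smul, SchwartzMap.fourier_coe, Real.fourier_eq']
    congr 3
    · congr 1
      field_simp
    · funext v
      rw [translateSchwartz_apply, inner_smul_right, real_inner_comm]
      congr 2
      push_cast
      have : (Real.pi : ℂ) ≠ 0 := by exact_mod_cast Real.pi_ne_zero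
      field_simp
  have hscale := Measure.integral_comp_smul (volume : Measure (MinkowskiSpace n))
    (fun w : MinkowskiSpace n => f (x - Real.pi • Matrix.toEuclideanLin Θ w) •
      (𝓕 (translateSchwartz x h)) w) ((2 * Real.pi)⁻¹)
  rw [moyalProd, (integral_congr_ae (Eventually.of_forall key)).trans hscale, smul_smul]
  have : |(((2 * Real.pi)⁻¹) ^ Module.finrank ℝ (MinkowskiSpace n))⁻¹| = (2 * Real.pi) ^ n := by
    rw [finrank_euclideanSpace_fin, inv_pow, inv_inv, abs_of_pos (by positivity)]
  rw [this, inv_mul_cancel₀ (pow_ne_zero _ hpi), one_smul]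

theorem integral_exp_smul_fourier (F : SpinorSchwartz n) (a : MinkowskiSpace n) :
    ∫ w : MinkowskiSpace n, Complex.exp (↑(2 * Real.pi * inner ℝ w a) * Complex.I) • (𝓕 F) w =
      F a := by
  have h : 𝓕⁻ (𝓕 F) a = F a := by rw [FourierTransform.fourierInv_fourier_eq]
  rw [SchwartzMap.fourierInv_coe, Real.fourierInv_eq'] at h
  exact h

variable {Θ}

/-- Left Moyal multiplication by a plane wave is a translation followed by a multiplication. -/
theorem moyalProd_planeWave (hΘ : Θᵀ = -Θ) (k : MinkowskiSpace n) (h : SpinorSchwartz n)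
    (x : MinkowskiSpace n) : moyalProd Θ (planeWave k) h x =
      planeWave k x • h (x + (1 / 2 : ℝ) • Matrix.toEuclideanLin Θ k) := by
  -- Skew-symmetry moves `Θ` from `w` to `k`: the factor e^{-iπ⟨k,Θw⟩} becomes e^{2πi⟨w,Θk/2⟩}, the
  -- kernel of Fourier inversion at Θk/2.
  have hskew : ∀ w : MinkowskiSpace n, inner ℝ k (Matrix.toEuclideanLin Θ w) =
      -inner ℝ w (Matrix.toEuclideanLin Θ k) := fun w => by
    have h1 : Matrix.toEuclideanLin (-Θ) = LinearMap.adjoint (Matrix.toEuclideanLin Θ) := by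
      rw [← Matrix.toEuclideanLin_conjTranspose_eq_adjoint, ← hΘ,
        Matrix.conjTranspose_eq_transpose_of_trivial]
    rw [← LinearMap.adjoint_inner_left, ← h1, map_neg, LinearMap.neg_apply, inner_neg_left,
      real_inner_comm]
  rw [moyalProd_eq_fourier, ← translateSchwartz_apply,
    ← integral_exp_smul_fourier (translateSchwartz x h), ← integral_smul]
  refine integral_congr_ae (Eventually.of_forall fun w => ?_)
  simp only [smul_smul]
  congr 1
  rw [sub_eq_add_neg, planeWave_add, ← smul_neg]
  congr 1
  simp only [planeWave, inner_smul_right, inner_neg_right, hskew]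
  congr 1
  push_cast
  ring

/-- Left Moyal multiplication commutes with plane waves in the kernel directions of `Θ`. -/
theorem moyalProd_smul_planeWave {a : MinkowskiSpace n} (ha : Matrix.toEuclideanLin Θ a = 0)
    (f : MinkowskiSpace n → ℂ) (h : MinkowskiSpace n → SpinorFibre n) (x : MinkowskiSpace n) :
    moyalProd Θ f (fun y => planeWave a y • h y) x = planeWave a x • moyalProd Θ f h x := by
  rw [moyalProd, moyalProd, smul_comm]
  congr 1
  have h1 : ∀ u : MinkowskiSpace n,
      (∫ v : MinkowskiSpace n, Complex.exp (-(Complex.I * (inner ℝ u v : ℝ))) •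
        (planeWave a (x + v) • h (x + v))) =
      planeWave a x • ∫ v : MinkowskiSpace n,
        Complex.exp (-(Complex.I * (inner ℝ (u - a) v : ℝ))) • h (x + v) := fun u => by
    rw [← integral_smul]
    congr 1
    funext v
    rw [planeWave_add, smul_smul, smul_smul, mul_left_comm]
    congr 2
    rw [planeWave, ← Complex.exp_add]
    congr 1
    rw [inner_sub_left]
    push_cast
    ring
  -- The wave shifts the frequency `u` by `a`. The shift is undone by translation invariance, which
  -- needs no integrability, and leaves the argument of `f` unchanged because `Θ a = 0`.
  have h2 := integral_sub_right_eq_self (μ := (volume : Measure (MinkowskiSpace n)))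
    (fun u : MinkowskiSpace n => f (x - (1 / 2 : ℝ) • Matrix.toEuclideanLin Θ u) •
      ∫ v : MinkowskiSpace n, Complex.exp (-(Complex.I * (inner ℝ u v : ℝ))) • h (x + v)) a
  rw [← h2, ← integral_smul]
  congr 1
  funext u
  rw [h1, map_sub, ha, sub_zero, smul_comm]

/-- Left Moyal multiplication commutes with invertible matrices acting on the fibre. -/
theorem moyalProd_fibre (e : SpinorFibre n ≃L[ℂ] SpinorFibre n)
    (f : MinkowskiSpace n → ℂ) (h : MinkowskiSpace n → SpinorFibre n) (x : MinkowskiSpace n) :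
    moyalProd Θ f (fun y => e (h y)) x = e (moyalProd Θ f h x) := by
  rw [moyalProd, moyalProd]
  simp only [← map_smul, e.integral_comp_comm]
  exact (map_smul (e.toContinuousLinearMap.restrictScalars ℝ) _ _).symm

variable [NeZero n] (Θ)

/-- Left Moyal multiplication by the time coordinate is `x⁰ + (i/2) Θ^{0μ} ∂_μ`. -/
theorem moyalProd_timeCoord (h : SpinorSchwartz n) :
    moyalProd Θ timeCoord h = timeSchwartz Θ h := by
  funext x
  set θ : MinkowskiSpace n := WithLp.toLp 2 (Θ 0) with hθ
  have hw : ∀ w : MinkowskiSpace n, (Matrix.toEuclideanLin Θ w) 0 = inner ℝ w θ := fun w => by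
    simp [Matrix.toLpLin_apply, Matrix.mulVec, dotProduct, PiLp.inner_apply, hθ]
  -- Chosen so that its Fourier transform is (x⁰ - π⟨w,θ⟩) times that of the translate:
  -- differentiation contributes 2πi⟨w,θ⟩, and (i/2)·2πi = -π. Fourier inversion at 0 then gives the
  -- claim.
  set F : SpinorSchwartz n := timeCoord x • translateSchwartz x h +
    (Complex.I / 2) • ∂_{θ} (translateSchwartz x h) with hF
  have hf : F 0 = timeSchwartz Θ h x := by
    rw [timeSchwartz_apply, hF, add_apply, smul_apply, smul_apply, translateSchwartz_apply,
      add_zero, SchwartzMap.lineDerivOp_apply_eq_fderiv]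
    have e : (translateSchwartz x h : MinkowskiSpace n → SpinorFibre n) = fun v => h (x + v) :=
      funext fun v => translateSchwartz_apply x v h
    rw [e, fderiv_comp_add_left, add_zero]
  have hg : (inner ℝ · θ : MinkowskiSpace n → ℝ).HasTemperateGrowth := by fun_prop
  rw [moyalProd_eq_fourier, ← hf, ← integral_exp_smul_fourier F]
  refine integral_congr_ae (Eventually.of_forall fun w => ?_)
  have hFF : 𝓕 F = timeCoord x • 𝓕 (translateSchwartz x h) +
      (Complex.I / 2) • 𝓕 (∂_{θ} (translateSchwartz x h)) := by
    rw [hF, FourierTransform.fourier_add, FourierTransform.fourier_smul,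
      FourierTransform.fourier_smul]
  simp only [inner_zero_right, mul_zero, Complex.ofReal_zero, zero_mul, Complex.exp_zero, one_smul]
  rw [hFF, add_apply, smul_apply, smul_apply, SchwartzMap.fourier_lineDerivOp_eq, smul_apply,
    SchwartzMap.smulLeftCLM_apply_apply hg, smul_smul]
  rw [← Complex.coe_smul (inner ℝ w θ), smul_smul, ← add_smul]
  congr 1
  simp only [timeCoord, PiLp.sub_apply, PiLp.smul_apply, hw, smul_eq_mul]
  push_cast
  linear_combination (-(Real.pi : ℂ) * (inner ℝ w θ : ℝ)) * Complex.I_sq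
end MoyalProduct

/-! ## Commutative time forces `Θ^{0μ} = 0` -/

section Necessity

variable {n : ℕ}

theorem exists_spinorSchwartz_ne_zero : ∃ ψ : SpinorSchwartz n, ψ ≠ 0 := by
  let b : ContDiffBump (0 : MinkowskiSpace n) := ⟨1, 2, one_pos, one_lt_two⟩
  -- The fibre has dimension 2^⌊n/2⌋ > 0, so it has a basis vector of index 0.
  let v : SpinorFibre n := EuclideanSpace.single ⟨0, by positivity⟩ 1
  have hv : v ≠ 0 := by simp [v]
  have hs : HasCompactSupport fun x => b x • v := b.hasCompactSupport.smul_right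
  refine ⟨hs.toSchwartzMap (b.contDiff.smul contDiff_const), fun h => hv ?_⟩
  have h0 : b 0 • v = 0 := congrArg (fun φ : SpinorSchwartz n => φ 0) h
  rwa [b.one_of_mem_closedBall (by simp [b]), one_smul] at h0

variable (Θ : Matrix (Fin n) (Fin n) ℝ)

/-- Left Moyal multiplication by a plane wave, on Schwartz spinors. -/
noncomputable def planeWaveSchwartz (k : MinkowskiSpace n) (ψ : SpinorSchwartz n) :
    SpinorSchwartz n :=
  SchwartzMap.smulLeftCLM (SpinorFibre n) (planeWave k)
    (translateSchwartz ((1 / 2 : ℝ) • Matrix.toEuclideanLin Θ k) ψ)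

theorem planeWaveSchwartz_apply (k x : MinkowskiSpace n) (ψ : SpinorSchwartz n) :
    planeWaveSchwartz Θ k ψ x =
      planeWave k x • ψ ((1 / 2 : ℝ) • Matrix.toEuclideanLin Θ k + x) := by
  rw [planeWaveSchwartz, SchwartzMap.smulLeftCLM_apply_apply (hasTemperateGrowth_planeWave k),
    translateSchwartz_apply]

theorem planeWaveSchwartz_injective (k : MinkowskiSpace n) :
    Function.Injective (planeWaveSchwartz Θ k) := by
  intro φ ψ h
  ext1 x
  have := congrArg (fun χ : SpinorSchwartz n => χ (x - (1 / 2 : ℝ) • Matrix.toEuclideanLin Θ k)) h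
  simp only [planeWaveSchwartz_apply, add_sub_cancel] at this
  refine smul_right_injective (SpinorFibre n) ?_ this
  rw [← norm_ne_zero_iff, norm_planeWave]
  exact one_ne_zero

/-- Left Moyal multiplication by a plane wave, on `L²`. -/
noncomputable def planeWaveOp (k : MinkowskiSpace n) : SpinorL2 n →L[ℂ] SpinorL2 n :=
  mulCLM (planeWaveBCF k) ∘L (Lp.compMeasurePreservingₗᵢ ℂ
    (fun x : MinkowskiSpace n => (1 / 2 : ℝ) • Matrix.toEuclideanLin Θ k + x)
    (measurePreserving_add_left volume _)).toContinuousLinearMap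

theorem planeWaveOp_spinorLp (k : MinkowskiSpace n) (ψ : SpinorSchwartz n) :
    planeWaveOp Θ k (spinorLp ψ) = spinorLp (planeWaveSchwartz Θ k ψ) := by
  have hm := measurePreserving_add_left (volume : Measure (MinkowskiSpace n))
    ((1 / 2 : ℝ) • Matrix.toEuclideanLin Θ k)
  have h1 : planeWaveOp Θ k (spinorLp ψ) =
      mulCLM (planeWaveBCF k) (Lp.compMeasurePreserving _ hm (spinorLp ψ)) := rfl
  rw [h1]
  refine Lp.ext ?_
  filter_upwards [coeFn_mulCLM (planeWaveBCF k) (Lp.compMeasurePreserving _ hm (spinorLp ψ)),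
    Lp.coeFn_compMeasurePreserving (spinorLp ψ) hm, coeFn_spinorLp (planeWaveSchwartz Θ k ψ),
    hm.quasiMeasurePreserving.ae_eq_comp (coeFn_spinorLp ψ)] with x h2 h3 h4 h5
  rw [h2, h3, h4, h5, planeWaveSchwartz_apply]
  rfl

variable {Θ}

/-- Provides the elements of the unitization against which commutative time is tested. -/
theorem isLeftMoyal_planeWaveOp (hΘ : Θᵀ = -Θ) (k : MinkowskiSpace n) :
    IsLeftMoyal Θ (planeWave k) (planeWaveOp Θ k) := fun ψ => by
  change planeWaveOp Θ k (spinorLp ψ) =ᵐ[volume] _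
  rw [planeWaveOp_spinorLp]
  filter_upwards [coeFn_spinorLp (planeWaveSchwartz Θ k ψ)] with x hx
  rw [hx, moyalProd_planeWave hΘ, planeWaveSchwartz_apply, add_comm]

variable [NeZero n] (Θ)

theorem timeSchwartz_sub_smul (φ ψ : SpinorSchwartz n) (c : ℂ) :
    timeSchwartz Θ (φ - c • ψ) = timeSchwartz Θ φ - c • timeSchwartz Θ ψ := by
  have h : ∂_{(WithLp.toLp 2 (Θ 0) : MinkowskiSpace n)} (φ - c • ψ) =
      ∂_{(WithLp.toLp 2 (Θ 0) : MinkowskiSpace n)} φ -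
        c • ∂_{(WithLp.toLp 2 (Θ 0) : MinkowskiSpace n)} ψ := by
    rw [sub_eq_add_neg, LineDeriv.lineDerivOp_add, LineDeriv.lineDerivOp_neg,
      LineDeriv.lineDerivOp_smul, sub_eq_add_neg]
  rw [timeSchwartz, timeSchwartz, timeSchwartz, h, map_sub, map_smul]
  module

/-- Conjugating the time operator by a plane wave shifts it by a constant. -/
theorem timeSchwartz_planeWave (k : MinkowskiSpace n) (ψ : SpinorSchwartz n) :
    timeSchwartz Θ (planeWaveSchwartz Θ k ψ) = planeWaveSchwartz Θ k
      (timeSchwartz Θ ψ - ((inner ℝ k (WithLp.toLp 2 (Θ 0)) : ℝ) : ℂ) • ψ) := by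
  ext1 x
  set θ : MinkowskiSpace n := WithLp.toLp 2 (Θ 0) with hθ
  set a : MinkowskiSpace n := (1 / 2 : ℝ) • Matrix.toEuclideanLin Θ k with ha
  -- The shift ⟨k,θ⟩ has two equal halves: this one from translating x⁰, the other from
  -- differentiating the wave, where (i/2)·i = -1/2.
  have ha0 : a 0 = (1 / 2 : ℝ) * inner ℝ k θ := by
    simp [ha, Matrix.toLpLin_apply, Matrix.mulVec, dotProduct, PiLp.inner_apply, hθ]
  have hpw : HasFDerivAt (planeWave k)
      (planeWave k x • Complex.I • Complex.ofRealCLM ∘L innerSL ℝ k) x :=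
    ((Complex.ofRealCLM ∘L innerSL ℝ k).hasFDerivAt.const_mul Complex.I).cexp
  have hψ : HasFDerivAt (fun y => ψ (a + y)) (fderiv ℝ ψ (a + x)) x :=
    (hasFDerivAt_comp_add_left a).2 (ψ.hasFDerivAt (a + x))
  have hfun : (planeWaveSchwartz Θ k ψ : MinkowskiSpace n → SpinorFibre n) =
      fun y => planeWave k y • ψ (a + y) := funext fun y => planeWaveSchwartz_apply Θ k y ψ
  rw [timeSchwartz_apply, planeWaveSchwartz_apply Θ k x (_ - _), sub_apply, timeSchwartz_apply,
    hfun, (hpw.fun_smul hψ).fderiv, smul_apply]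
  simp only [timeCoord, PiLp.add_apply, ha0, add_apply,
    smul_apply, ContinuousLinearMap.smulRight_apply,
    ContinuousLinearMap.comp_apply, innerSL_apply_apply, Complex.ofRealCLM_apply, smul_add,
    smul_sub, smul_smul, ← hθ, smul_eq_mul, ← ha]
  rw [add_sub_right_comm, ← sub_smul, add_comm (_ • fderiv ℝ ψ (a + x) θ), ← add_assoc, ← add_smul,
    mul_comm (Complex.I / 2) (planeWave k x)]
  congr 2
  push_cast
  linear_combination (planeWave k x * (inner ℝ k θ : ℝ) / 2) * Complex.I_sq

variable {Θ}

/-- The plane wave operator commutes with T² and also conjugates T into T - c, so (T - c)² = T².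
Only the equation for S² is used, so the choice of square root is immaterial. -/
theorem smul_timeSchwartz_of_hasCommutativeTime (hΘ : Θᵀ = -Θ)
    {γ : Fin n → Matrix (Fin (2 ^ (n / 2))) (Fin (2 ^ (n / 2))) ℂ}
    (h : (moyalMinkowski Θ γ).HasCommutativeTime) (k : MinkowskiSpace n) (ψ : SpinorSchwartz n) :
    (2 * ((inner ℝ k (WithLp.toLp 2 (Θ 0)) : ℝ) : ℂ)) • timeSchwartz Θ ψ =
      (((inner ℝ k (WithLp.toLp 2 (Θ 0)) : ℝ) : ℂ) ^ 2) • ψ := by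
  obtain ⟨S, hS, hcomm⟩ := h
  set c : ℂ := ((inner ℝ k (WithLp.toLp 2 (Θ 0)) : ℝ) : ℂ) with hc
  have hA := (hcomm (planeWaveOp Θ k)
    ⟨_, isSmoothBounded_planeWave k, isLeftMoyal_planeWaveOp hΘ k⟩).1.opMul_self
  rw [hS.sq_eq] at hA
  have hA2 := commutesWith_iff.1 hA.of_id_vadd
  have hT : ∀ φ : SpinorSchwartz n, (spinorLp φ, spinorLp (timeSchwartz Θ φ)) ∈
      (moyalMinkowski Θ γ).time.graph :=
    spinorLp_mem_graph (moyalProd_timeCoord Θ) (isSchwartzAdjoint_time Θ)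
  have hTT : ∀ φ : SpinorSchwartz n, (spinorLp φ, spinorLp (timeSchwartz Θ (timeSchwartz Θ φ))) ∈
      (opMul (moyalMinkowski Θ γ).time (moyalMinkowski Θ γ).time).graph := fun φ =>
    mem_graph_opMul.2 ⟨_, hT φ, hT _⟩
  have h1 := hA2 _ _ (hTT ψ)
  rw [planeWaveOp_spinorLp, planeWaveOp_spinorLp] at h1
  -- Two values of T² at U_kψ: one from commutation, one from direct computation on a Schwartz
  -- spinor.
  have h2 := LinearPMap.mem_graph_snd_inj _ h1 (hTT _) rfl
  have h3 := spinorLp_injective h2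
  rw [timeSchwartz_planeWave, timeSchwartz_planeWave] at h3
  have h4 := planeWaveSchwartz_injective Θ k h3
  rw [timeSchwartz_sub_smul, ← hc] at h4
  have h5 : timeSchwartz Θ (timeSchwartz Θ ψ) - c • timeSchwartz Θ ψ -
      c • (timeSchwartz Θ ψ - c • ψ) - timeSchwartz Θ (timeSchwartz Θ ψ) = 0 :=
    sub_eq_zero.2 h4.symm
  rw [← sub_eq_zero, ← neg_eq_zero, ← h5]
  module

/-- The relation 2cT = c² is linear in c on the left and quadratic on the right, so applying it to k
= θ and k = 2θ eliminates T and forces c = |θ|² to vanish. -/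
theorem theta_eq_zero_of_hasCommutativeTime (hΘ : Θᵀ = -Θ)
    {γ : Fin n → Matrix (Fin (2 ^ (n / 2))) (Fin (2 ^ (n / 2))) ℂ}
    (h : (moyalMinkowski Θ γ).HasCommutativeTime) : Θ 0 = 0 := by
  obtain ⟨ψ, hψ⟩ := exists_spinorSchwartz_ne_zero (n := n)
  set θ : MinkowskiSpace n := WithLp.toLp 2 (Θ 0) with hθ
  have h1 := smul_timeSchwartz_of_hasCommutativeTime hΘ h θ ψ
  have h2 := smul_timeSchwartz_of_hasCommutativeTime hΘ h ((2 : ℝ) • θ) ψ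
  rw [inner_smul_left, ← hθ] at h2
  rw [← hθ] at h1
  set c : ℝ := inner ℝ θ θ with hc
  have h3 : ((c : ℂ) ^ 2 * 2) • ψ = 0 := by
    have e1 := sub_eq_zero.2 h1
    have e2 := sub_eq_zero.2 h2
    simp only [conj_trivial] at e2
    push_cast at e2
    have : ((c : ℂ) ^ 2 * 2) • ψ = (2 : ℂ) • ((2 * (c : ℂ)) • timeSchwartz Θ ψ - (c : ℂ) ^ 2 • ψ) -
        ((2 * (2 * (c : ℂ))) • timeSchwartz Θ ψ - (2 * (c : ℂ)) ^ 2 • ψ) := by module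
    rw [this, e1, e2, smul_zero, sub_zero]
  have h4 : (c : ℂ) ^ 2 * 2 = 0 := (smul_eq_zero.1 h3).resolve_right hψ
  have h5 : c = 0 := by simpa using h4
  have h6 : θ = 0 := inner_self_eq_zero.1 h5
  have := congrArg WithLp.ofLp h6
  simpa [hθ] using this

end Necessity

/-! ## Functions of time -/

section FunctionsOfTime

variable {n : ℕ} [NeZero n]

/-- The unit vector in the time direction. -/
noncomputable def timeVec : MinkowskiSpace n := EuclideanSpace.single 0 1

theorem inner_smul_timeVec (k : ℝ) (x : MinkowskiSpace n) :
    inner ℝ (k • timeVec) x = k * x 0 := by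
  rw [inner_smul_left, timeVec, EuclideanSpace.inner_single_left]
  simp

theorem continuous_time : Continuous fun x : MinkowskiSpace n => x 0 := by fun_prop

/-- A bounded continuous function of time. -/
noncomputable def ofTime (g : ℝ →ᵇ ℂ) : MinkowskiSpace n →ᵇ ℂ :=
  g.compContinuous ⟨fun x => x 0, continuous_time⟩

theorem ofTime_apply (g : ℝ →ᵇ ℂ) (x : MinkowskiSpace n) : ofTime g x = g (x 0) := rfl

/-- Multiplication by a Schwartz function of time is a superposition of plane waves. -/
theorem inner_mulCLM_ofTime (g : 𝓢(ℝ, ℂ)) (φ ψ : SpinorL2 n) :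
    inner ℂ φ (mulCLM (ofTime g.toBoundedContinuousFunction) ψ) =
      ∫ k : ℝ, (𝓕 g) k *
        inner ℂ φ (mulCLM (planeWaveBCF ((2 * Real.pi * k) • timeVec)) ψ) := by
  have hinv : ∀ t : ℝ, g t =
      ∫ k : ℝ, Complex.exp (↑(2 * Real.pi * k * t) * Complex.I) * (𝓕 g) k := by
    intro t
    have h : 𝓕⁻ (𝓕 g) t = g t := by rw [FourierTransform.fourierInv_fourier_eq]
    rw [← h, SchwartzMap.fourierInv_coe, Real.fourierInv_eq']
    refine integral_congr_ae (Eventually.of_forall fun k => ?_)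
    simp only [smul_eq_mul, RCLike.inner_apply, conj_trivial]
    congr 4
    ring
  have hF : Integrable (fun y : MinkowskiSpace n => inner ℂ (φ y) (ψ y)) :=
    L2.integrable_inner φ ψ
  have hl : inner ℂ φ (mulCLM (ofTime g.toBoundedContinuousFunction) ψ) =
      ∫ y : MinkowskiSpace n, ∫ k : ℝ,
        Complex.exp (↑(2 * Real.pi * k * y 0) * Complex.I) * (𝓕 g) k * inner ℂ (φ y) (ψ y) := by
    rw [L2.inner_def]
    refine integral_congr_ae ?_
    filter_upwards [coeFn_mulCLM (ofTime g.toBoundedContinuousFunction) ψ] with y hy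
    rw [hy, inner_smul_right, ofTime_apply, SchwartzMap.toBoundedContinuousFunction_apply, hinv,
      integral_mul_const]
  rw [hl, integral_integral_swap]
  · refine integral_congr_ae (Eventually.of_forall fun k => ?_)
    simp only
    rw [L2.inner_def, ← integral_const_mul]
    refine integral_congr_ae ?_
    filter_upwards [coeFn_mulCLM (planeWaveBCF ((2 * Real.pi * k) • timeVec)) ψ] with y hy
    rw [hy, inner_smul_right, planeWaveBCF_apply, planeWave, inner_smul_timeVec,
      mul_comm Complex.I]
    ring
  · have hint : Integrable (fun p : MinkowskiSpace n × ℝ => inner ℂ (φ p.1) (ψ p.1) * (𝓕 g) p.2)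
        (volume.prod volume) := hF.mul_prod (𝓕 g).integrable
    have hb := hint.bdd_mul (c := 1)
      (f := fun p : MinkowskiSpace n × ℝ => Complex.exp (↑(2 * Real.pi * p.2 * p.1 0) * Complex.I))
      (Continuous.aestronglyMeasurable (by fun_prop))
      (Eventually.of_forall fun p => (Complex.norm_exp_ofReal_mul_I _).le)
    refine hb.congr (Eventually.of_forall fun p => ?_)
    simp only [Function.uncurry]
    ring

variable {A : SpinorL2 n →L[ℂ] SpinorL2 n}

/-- Fourier inversion is used in weak form: moving `A` to the other side as its adjoint carries it
past the integral over `k` with no operator-valued integration. -/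
theorem commute_ofTime_schwartz
    (hA : ∀ (k : ℝ) ψ, A (mulCLM (planeWaveBCF (k • timeVec)) ψ) =
      mulCLM (planeWaveBCF (k • timeVec)) (A ψ)) (g : 𝓢(ℝ, ℂ)) (ψ : SpinorL2 n) :
    A (mulCLM (ofTime g.toBoundedContinuousFunction) ψ) =
      mulCLM (ofTime g.toBoundedContinuousFunction) (A ψ) := by
  refine ext_inner_left ℂ fun φ => ?_
  rw [← ContinuousLinearMap.adjoint_inner_left, inner_mulCLM_ofTime, inner_mulCLM_ofTime]
  simp only [ContinuousLinearMap.adjoint_inner_left, hA]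

/-- An operator that commutes with all plane waves in the time direction commutes with
multiplication by every smooth function of time. -/
theorem commutesWith_mulOp_time
    (hA : ∀ (k : ℝ) ψ, A (mulCLM (planeWaveBCF (k • timeVec)) ψ) =
      mulCLM (planeWaveBCF (k • timeVec)) (A ψ)) {g : ℝ → ℂ} (hg : ContDiff ℝ ∞ g) :
    CommutesWith A (mulOp fun x => g (x 0)) := by
  rw [commutesWith_iff]
  intro x y hxy
  rw [mem_graph_mulOp] at hxy ⊢
  -- Cutoffs equal to 1 on |t| ≤ m + 1. Both `b m` and `b m * g` are Schwartz, so y = g x becomes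
  -- the relation b_m y = (b_m g) x between bounded multiplications, to which `A` applies.
  let b : ℕ → ContDiffBump (0 : ℝ) := fun m => ⟨m + 1, m + 2, by positivity, by linarith⟩
  have hb : ∀ m, HasCompactSupport fun t => (b m t : ℂ) := fun m =>
    (b m).hasCompactSupport.comp_left Complex.ofReal_zero
  have hbs : ∀ m, ContDiff ℝ ∞ fun t => (b m t : ℂ) := fun m =>
    Complex.ofRealCLM.contDiff.comp (b m).contDiff
  let φ : ℕ → 𝓢(ℝ, ℂ) := fun m => (hb m).toSchwartzMap (hbs m)
  let χ : ℕ → 𝓢(ℝ, ℂ) := fun m => ((hb m).mul_right (f' := g)).toSchwartzMap ((hbs m).mul hg)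
  have key : ∀ m, mulCLM (ofTime (φ m).toBoundedContinuousFunction) (A y) =
      mulCLM (ofTime (χ m).toBoundedContinuousFunction) (A x) := fun m => by
    rw [← commute_ofTime_schwartz hA, ← commute_ofTime_schwartz hA]
    congr 1
    refine Lp.ext ?_
    filter_upwards [hxy, coeFn_mulCLM (ofTime (φ m).toBoundedContinuousFunction) y,
      coeFn_mulCLM (ofTime (χ m).toBoundedContinuousFunction) x] with t h1 h2 h3
    rw [h2, h3, h1, smul_smul]
    rfl
  -- A single null set serves all `m`; at each remaining point, some cutoff equals 1.
  have hae : ∀ᵐ t : MinkowskiSpace n, ∀ m, (b m (t 0) : ℂ) • A y t =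
      ((b m (t 0) : ℂ) * g (t 0)) • A x t := by
    rw [ae_all_iff]
    intro m
    filter_upwards [coeFn_mulCLM (ofTime (φ m).toBoundedContinuousFunction) (A y),
      coeFn_mulCLM (ofTime (χ m).toBoundedContinuousFunction) (A x)] with t h1 h2
    rw [key m, h2] at h1
    exact h1.symm
  filter_upwards [hae] with t ht
  obtain ⟨m, hm⟩ := exists_nat_ge |t 0|
  have h1 : b m (t 0) = 1 := (b m).one_of_mem_closedBall (by
    simp only [Metric.mem_closedBall, dist_zero_right, Real.norm_eq_abs, b]; linarith)
  simpa [h1] using ht m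

end FunctionsOfTime

/-! ## Left Moyal multiplication on `L²` -/

section LeftMoyal

variable {n : ℕ} {Θ : Matrix (Fin n) (Fin n) ℝ} {f : MinkowskiSpace n → ℂ}
  {A : SpinorL2 n →L[ℂ] SpinorL2 n}

/-- On Schwartz spinors this is `moyalProd_smul_planeWave`; density and boundedness extend it to L².
-/
theorem IsLeftMoyal.commute_planeWave (hA : IsLeftMoyal Θ f A) {a : MinkowskiSpace n}
    (ha : Matrix.toEuclideanLin Θ a = 0) (ψ : SpinorL2 n) :
    A (mulCLM (planeWaveBCF a) ψ) = mulCLM (planeWaveBCF a) (A ψ) := by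
  refine congrFun (Continuous.ext_on denseRange_spinorLp
    (f := fun ψ => A (mulCLM (planeWaveBCF a) ψ)) (g := fun ψ => mulCLM (planeWaveBCF a) (A ψ))
    (by fun_prop) (by fun_prop) ?_) ψ
  rintro _ ⟨φ, rfl⟩
  have hp : (planeWaveBCF a : MinkowskiSpace n → ℂ).HasTemperateGrowth :=
    hasTemperateGrowth_planeWave a
  simp only
  rw [mulCLM_spinorLp _ hp]
  refine Lp.ext ?_
  filter_upwards [hA φ, hA (SchwartzMap.smulLeftCLM (SpinorFibre n) (planeWaveBCF a) φ),
    coeFn_mulCLM (planeWaveBCF a) (A (spinorLp φ))] with x h1 h2 h3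
  have e : (SchwartzMap.smulLeftCLM (SpinorFibre n) (planeWaveBCF a) φ :
      MinkowskiSpace n → SpinorFibre n) = fun y => planeWave a y • φ y :=
    funext fun y => SchwartzMap.smulLeftCLM_apply_apply hp φ y
  rw [e, moyalProd_smul_planeWave ha] at h2
  rw [h3]
  refine h2.trans ?_
  rw [← h1]
  rfl

/-- The action of a constant matrix on `L²` spinors. -/
noncomputable def fibreLp (M : Matrix (Fin (2 ^ (n / 2))) (Fin (2 ^ (n / 2))) ℂ) :
    SpinorL2 n →L[ℂ] SpinorL2 n :=
  (fibreCLM M).compLpL 2 volume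

theorem coeFn_fibreLp (M : Matrix (Fin (2 ^ (n / 2))) (Fin (2 ^ (n / 2))) ℂ) (ψ : SpinorL2 n) :
    fibreLp M ψ =ᵐ[volume] fun x => fibreCLM M (ψ x) :=
  (fibreCLM M).coeFn_compLpL ψ

theorem fibreLp_spinorLp (M : Matrix (Fin (2 ^ (n / 2))) (Fin (2 ^ (n / 2))) ℂ)
    (ψ : SpinorSchwartz n) : fibreLp M (spinorLp ψ) = spinorLp (ψ.postcompCLM (fibreCLM M)) := by
  refine Lp.ext ?_
  filter_upwards [coeFn_fibreLp M (spinorLp ψ), coeFn_spinorLp ψ,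
    coeFn_spinorLp (ψ.postcompCLM (fibreCLM M))] with x h1 h2 h3
  rw [h1, h2, h3, SchwartzMap.postcompCLM_apply]

/-- Invertibility of the matrix lets it pass through the integrals of the Moyal product with no
integrability condition on `f`. -/
theorem IsLeftMoyal.commute_fibre (hA : IsLeftMoyal Θ f A)
    {M M' : Matrix (Fin (2 ^ (n / 2))) (Fin (2 ^ (n / 2))) ℂ} (h : M * M' = 1) (h' : M' * M = 1)
    (ψ : SpinorL2 n) : A (fibreLp M ψ) = fibreLp M (A ψ) := by
  have hinv : ∀ {N N' : Matrix (Fin (2 ^ (n / 2))) (Fin (2 ^ (n / 2))) ℂ}, N * N' = 1 →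
      Function.LeftInverse (fibreCLM N) (fibreCLM N') := fun {N N'} hN v => by
    have := congrArg (fun T : SpinorFibre n →L[ℂ] SpinorFibre n => T v)
      (map_mul (Matrix.toEuclideanCLM (𝕜 := ℂ)) N N')
    rw [hN, map_one] at this
    exact this.symm
  let e : SpinorFibre n ≃L[ℂ] SpinorFibre n :=
    ContinuousLinearEquiv.equivOfInverse (fibreCLM M) (fibreCLM M') (hinv h') (hinv h)
  refine congrFun (Continuous.ext_on denseRange_spinorLp
    (f := fun ψ => A (fibreLp M ψ)) (g := fun ψ => fibreLp M (A ψ))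
    (by fun_prop) (by fun_prop) ?_) ψ
  rintro _ ⟨φ, rfl⟩
  simp only
  rw [fibreLp_spinorLp]
  refine Lp.ext ?_
  filter_upwards [hA φ, hA (φ.postcompCLM (fibreCLM M)), coeFn_fibreLp M (A (spinorLp φ))]
    with x h1 h2 h3
  have he : (φ.postcompCLM (fibreCLM M) : MinkowskiSpace n → SpinorFibre n) = fun y => e (φ y) :=
    funext fun y => SchwartzMap.postcompCLM_apply _ _ _
  rw [he, moyalProd_fibre] at h2
  rw [h3]
  refine h2.trans ?_
  rw [← h1]
  rfl

end LeftMoyal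

/-! ## `Θ^{0μ} = 0` implies commutative time -/

section Sufficiency

/-- The powers `(1 + t ^ 2) ^ r`. -/
noncomputable def japanese (r t : ℝ) : ℂ := (((1 + t ^ 2) ^ r : ℝ) : ℂ)

theorem hasTemperateGrowth_japanese (r : ℝ) : (japanese r).HasTemperateGrowth := by
  have h := Function.hasTemperateGrowth_one_add_norm_sq_rpow ℝ r
  have e : japanese r = Complex.ofReal ∘ fun x : ℝ => (1 + ‖x‖ ^ 2) ^ r := by
    funext t
    simp [japanese]
  rw [e]
  exact Complex.ofRealCLM.hasTemperateGrowth.comp h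

theorem japanese_half_sq (t : ℝ) : japanese (1 / 2) t ^ 2 = 1 + (t : ℂ) ^ 2 := by
  have h : ((1 + t ^ 2) ^ (1 / 2 : ℝ) : ℝ) ^ 2 = 1 + t ^ 2 := by
    rw [← Real.sqrt_eq_rpow, Real.sq_sqrt (by positivity)]
  rw [japanese, ← Complex.ofReal_pow, h]
  push_cast
  ring

theorem japanese_mul_neg (r t : ℝ) : japanese r t * japanese (-r) t = 1 := by
  rw [japanese, japanese, ← Complex.ofReal_mul, ← Real.rpow_add (by positivity), add_neg_cancel,
    Real.rpow_zero, Complex.ofReal_one]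

theorem hasDerivAt_japanese_half (t : ℝ) :
    HasDerivAt (japanese (1 / 2)) (t * japanese (-(1 / 2)) t) t := by
  have h := (((hasDerivAt_pow 2 t).const_add 1).rpow_const (p := 1 / 2)
    (Or.inl (by positivity))).ofReal_comp
  refine h.congr_deriv ?_
  rw [japanese, show (1 / 2 - 1 : ℝ) = -(1 / 2) by norm_num]
  push_cast
  ring

theorem norm_japanese_neg_half_le (t : ℝ) : ‖japanese (-(1 / 2)) t‖ ≤ 1 := by
  rw [japanese, Complex.norm_real, Real.norm_of_nonneg (by positivity)]
  exact Real.rpow_le_one_of_one_le_of_nonpos (by nlinarith [sq_nonneg t]) (by norm_num)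

theorem norm_mul_japanese_neg_half_le (t : ℝ) : ‖(t : ℂ) * japanese (-(1 / 2)) t‖ ≤ 1 := by
  rw [norm_mul, Complex.norm_real, Real.norm_eq_abs, japanese, Complex.norm_real,
    Real.norm_of_nonneg (by positivity), Real.rpow_neg (by positivity), ← Real.sqrt_eq_rpow,
    ← div_eq_mul_inv]
  refine div_le_one_of_le₀ (Real.abs_le_sqrt ?_) (Real.sqrt_nonneg _)
  linarith

/-- The function `(1 + t ^ 2) ^ (-1 / 2)`. -/
noncomputable def japaneseInv : ℝ →ᵇ ℂ :=
  BoundedContinuousFunction.ofNormedAddCommGroup (japanese (-(1 / 2)))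
    (hasTemperateGrowth_japanese _).1.continuous 1 norm_japanese_neg_half_le

theorem hasTemperateGrowth_mul_japanese :
    (fun t : ℝ => (t : ℂ) * japanese (-(1 / 2)) t).HasTemperateGrowth :=
  Complex.ofRealCLM.hasTemperateGrowth.mul (hasTemperateGrowth_japanese _)

/-- The derivative `t (1 + t ^ 2) ^ (-1 / 2)` of `(1 + t ^ 2) ^ (1 / 2)`. -/
noncomputable def japaneseDeriv : ℝ →ᵇ ℂ :=
  BoundedContinuousFunction.ofNormedAddCommGroup (fun t : ℝ => (t : ℂ) * japanese (-(1 / 2)) t)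
    hasTemperateGrowth_mul_japanese.1.continuous 1 norm_mul_japanese_neg_half_le

theorem hasTemperateGrowth_japaneseDeriv :
    (japaneseDeriv : ℝ → ℂ).HasTemperateGrowth := hasTemperateGrowth_mul_japanese

variable {n : ℕ} [NeZero n]

theorem hasTemperateGrowth_comp_time {g : ℝ → ℂ} (hg : g.HasTemperateGrowth) :
    (fun x : MinkowskiSpace n => g (x 0)).HasTemperateGrowth :=
  hg.comp (EuclideanSpace.proj (𝕜 := ℝ) (ι := Fin n) (0 : Fin n)).hasTemperateGrowth

/-- The function `(1 + (x⁰) ^ 2) ^ (1 / 2)`. -/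
noncomputable def timeWeight (x : MinkowskiSpace n) : ℂ := japanese (1 / 2) (x 0)

theorem hasTemperateGrowth_timeWeight : (timeWeight (n := n)).HasTemperateGrowth :=
  hasTemperateGrowth_comp_time (hasTemperateGrowth_japanese _)

theorem star_timeWeight (x : MinkowskiSpace n) : star (timeWeight x) = timeWeight x :=
  Complex.conj_ofReal _

theorem timeWeight_sq (x : MinkowskiSpace n) : timeWeight x ^ 2 = 1 + timeCoord x ^ 2 :=
  japanese_half_sq _

theorem timeWeight_mul_inv (x : MinkowskiSpace n) : timeWeight x * ofTime japaneseInv x = 1 :=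
  japanese_mul_neg _ _

theorem isSqrtOneAddSq_timeWeight :
    IsSqrtOneAddSq (mulOp timeCoord) (mulOp (timeWeight (n := n))) where
  selfAdjoint := isSelfAdjoint_mulOp hasTemperateGrowth_timeWeight star_timeWeight
    (ofTime japaneseInv) timeWeight_mul_inv
  nonneg := mulOp_inner_nonneg star_timeWeight fun x => by
    rw [timeWeight, japanese, Complex.ofReal_re]
    positivity
  sq_eq := opMul_mulOp_self_eq timeWeight_sq (ofTime japaneseInv) (ofTime japaneseDeriv)
    timeWeight_mul_inv fun _ => rfl

/-- With row 0 of `Θ` zero the derivative term of the time operator disappears, and Schwartz spinors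
form a core for multiplication by x⁰. -/
theorem time_eq_mulOp {Θ : Matrix (Fin n) (Fin n) ℝ} (hΘ : Θ 0 = 0)
    (γ : Fin n → Matrix (Fin (2 ^ (n / 2))) (Fin (2 ^ (n / 2))) ℂ) :
    (moyalMinkowski Θ γ).time = mulOp timeCoord := by
  refine closureOfSchwartzOp_eq_mulOp timeWeight_sq hasTemperateGrowth_timeCoord
    (ofTime japaneseInv) (ofTime japaneseDeriv) timeWeight_mul_inv (fun _ => rfl)
    (hasTemperateGrowth_comp_time (hasTemperateGrowth_japanese _)) (fun ψ => ?_)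
    (isSchwartzAdjoint_smulLeft hasTemperateGrowth_timeCoord fun x => Complex.conj_ofReal _)
  change moyalProd Θ timeCoord ψ = _
  rw [moyalProd_timeCoord, timeSchwartz, hΘ]
  congr 1
  rw [WithLp.toLp_zero, LineDeriv.lineDerivOp_left_zero, smul_zero, add_zero]

variable (γ : Fin n → Matrix (Fin (2 ^ (n / 2))) (Fin (2 ^ (n / 2))) ℂ)

/-- The commutator of the Dirac operator with `(1 + (x⁰) ^ 2) ^ (1 / 2)` on Schwartz spinors. -/
noncomputable def commSchwartz (ψ : SpinorSchwartz n) : SpinorSchwartz n :=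
  -Complex.I • (SchwartzMap.smulLeftCLM (SpinorFibre n) (ofTime japaneseDeriv) ψ).postcompCLM
    (fibreCLM (γ 0))

/-- The product rule for the Dirac operator and `(1 + (x⁰) ^ 2) ^ (1 / 2)`. -/
theorem diracSchwartz_timeWeight (ψ : SpinorSchwartz n) :
    diracSchwartz γ (SchwartzMap.smulLeftCLM (SpinorFibre n) timeWeight ψ) =
      SchwartzMap.smulLeftCLM (SpinorFibre n) timeWeight (diracSchwartz γ ψ) +
        commSchwartz γ ψ := by
  ext1 x
  have hk : (ofTime japaneseDeriv : MinkowskiSpace n → ℂ).HasTemperateGrowth :=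
    hasTemperateGrowth_comp_time hasTemperateGrowth_japaneseDeriv
  have hs : HasFDerivAt (timeWeight (n := n)) ((ContinuousLinearMap.toSpanSingleton ℝ
      (ofTime japaneseDeriv x)) ∘L EuclideanSpace.proj (𝕜 := ℝ) (ι := Fin n) (0 : Fin n)) x :=
    (hasDerivAt_japanese_half (x 0)).hasFDerivAt.comp x
      (EuclideanSpace.proj (𝕜 := ℝ) (ι := Fin n) (0 : Fin n)).hasFDerivAt
  have hfun : (SchwartzMap.smulLeftCLM (SpinorFibre n) timeWeight ψ :
      MinkowskiSpace n → SpinorFibre n) = fun y => timeWeight y • ψ y :=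
    funext fun y => SchwartzMap.smulLeftCLM_apply_apply hasTemperateGrowth_timeWeight ψ y
  rw [add_apply, SchwartzMap.smulLeftCLM_apply_apply hasTemperateGrowth_timeWeight,
    diracSchwartz_apply, diracSchwartz_apply, hfun, (hs.fun_smul (ψ.hasFDerivAt x)).fderiv,
    commSchwartz, smul_apply, SchwartzMap.postcompCLM_apply,
    SchwartzMap.smulLeftCLM_apply_apply hk, smul_comm (timeWeight x), ← smul_add]
  congr 1
  -- The γ⁰ term is spread over all μ with weights ∂_μ x⁰, so that the product rule can be compared
  -- term by term.
  have h0 : fibreCLM (γ 0) (ofTime japaneseDeriv x • ψ x) = ∑ μ,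
      fibreCLM (γ μ) (((EuclideanSpace.single μ 1 : MinkowskiSpace n) 0) •
        ofTime japaneseDeriv x • ψ x) := by
    rw [Finset.sum_eq_single 0 (fun μ _ hμ => ?_) (by simp)]
    · simp
    · simp [hμ.symm]
  rw [h0, Finset.smul_sum, ← Finset.sum_add_distrib]
  refine Finset.sum_congr rfl fun μ _ => ?_
  rw [← map_smul, ← map_add]
  congr 1
  simp

theorem isSchwartzAdjoint_comm :
    IsSchwartzAdjoint (commSchwartz γ) fun φ => -commSchwartz (fun μ => (γ μ)ᴴ) φ := by
  have hk : (ofTime japaneseDeriv : MinkowskiSpace n → ℂ).HasTemperateGrowth :=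
    hasTemperateGrowth_comp_time hasTemperateGrowth_japaneseDeriv
  have := ((isSchwartzAdjoint_fibre (γ 0)).comp (isSchwartzAdjoint_smulLeft hk fun x => by
    rw [ofTime_apply]
    change star (((x 0 : ℝ) : ℂ) * japanese _ _) = _ * japanese _ _
    rw [japanese, ← Complex.ofReal_mul]
    exact Complex.conj_ofReal _)).smul (-Complex.I)
  convert this using 2 with φ
  · rfl
  · rw [commSchwartz, ← neg_smul]
    congr 1
    · simp
    · ext1 x
      simp only [SchwartzMap.postcompCLM_apply, SchwartzMap.smulLeftCLM_apply_apply hk, map_smul]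

/-- The commutator of the Dirac operator with `(1 + (x⁰) ^ 2) ^ (1 / 2)` on `L²`. -/
noncomputable def commOp : SpinorL2 n →L[ℂ] SpinorL2 n :=
  -Complex.I • (fibreLp (γ 0) ∘L mulCLM (ofTime japaneseDeriv))

theorem commOp_spinorLp (ψ : SpinorSchwartz n) :
    commOp γ (spinorLp ψ) = spinorLp (commSchwartz γ ψ) := by
  have hk : (ofTime japaneseDeriv : MinkowskiSpace n → ℂ).HasTemperateGrowth :=
    hasTemperateGrowth_comp_time hasTemperateGrowth_japaneseDeriv
  rw [commOp, commSchwartz, spinorLp_smul, ← fibreLp_spinorLp, ← mulCLM_spinorLp _ hk]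
  rfl

theorem inner_commOp (φ : SpinorSchwartz n) (x : SpinorL2 n) :
    inner ℂ (spinorLp φ) (commOp γ x) =
      inner ℂ (spinorLp (-commSchwartz (fun μ => (γ μ)ᴴ) φ)) x := by
  refine congrFun (Continuous.ext_on denseRange_spinorLp
    (f := fun x => inner ℂ (spinorLp φ) (commOp γ x))
    (g := fun x => inner ℂ (spinorLp (-commSchwartz (fun μ => (γ μ)ᴴ) φ)) x)
    (by fun_prop) (by fun_prop) ?_) x
  rintro _ ⟨ψ, rfl⟩
  simp only
  rw [commOp_spinorLp]
  exact isSchwartzAdjoint_comm γ φ ψ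

/-- On its natural domain, the commutator of the Dirac operator with `(1 + (x⁰) ^ 2) ^ (1 / 2)` is
bounded. -/
theorem eq_commOp_of_mem_graph {x y : SpinorL2 n}
    (h : (x, y) ∈ (opMul (closureOfSchwartzOp (flatDirac γ)) (mulOp timeWeight) -
      opMul (mulOp timeWeight) (closureOfSchwartzOp (flatDirac γ))).graph) :
    y = commOp γ x := by
  obtain ⟨y₁, y₂, h1, h2, rfl⟩ := mem_graph_sub.1 h
  obtain ⟨w, hw, hy₁⟩ := mem_graph_opMul.1 h1
  obtain ⟨v, hv, hy₂⟩ := mem_graph_opMul.1 h2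
  have hsS : ∀ φ : SpinorSchwartz n, spinorLp (SchwartzMap.smulLeftCLM (SpinorFibre n) timeWeight φ)
      =ᵐ[volume] fun t => timeWeight t • spinorLp φ t := fun φ =>
    mem_graph_mulOp.1 (spinorLp_mem_graph_mulOp hasTemperateGrowth_timeWeight φ)
  refine eq_of_inner_spinorLp_eq fun φ => ?_
  have hD := isSchwartzAdjoint_dirac γ
  -- All operators are moved onto the Schwartz spinor `φ`, where the product rule for the adjoint
  -- Dirac operator holds; `x` itself need not be smooth.
  rw [inner_sub_right, inner_eq_of_mem_graph (flatDirac_eq γ) hD hy₁,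
    ← inner_eq_of_ae_eq_smul star_timeWeight (hsS _) (mem_graph_mulOp.1 hw),
    ← inner_eq_of_ae_eq_smul star_timeWeight (hsS _) (mem_graph_mulOp.1 hy₂),
    inner_eq_of_mem_graph (flatDirac_eq γ) hD hv, ← inner_sub_left, ← spinorLp_sub,
    diracSchwartz_timeWeight, inner_commOp]
  congr 2
  abel

theorem dense_domain_commutator :
    Dense ((opMul (closureOfSchwartzOp (flatDirac γ)) (mulOp timeWeight) -
      opMul (mulOp timeWeight) (closureOfSchwartzOp (flatDirac γ))).domain : Set (SpinorL2 n)) := by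
  refine Dense.mono ?_ denseRange_spinorLp
  rintro _ ⟨ψ, rfl⟩
  have hS := spinorLp_mem_graph_mulOp (hasTemperateGrowth_timeWeight (n := n))
  have hD := spinorLp_mem_graph (flatDirac_eq γ) (isSchwartzAdjoint_dirac γ)
  exact LinearPMap.mem_domain_of_mem_graph (mem_graph_sub.2
    ⟨_, _, mem_graph_opMul.2 ⟨_, hS ψ, hD _⟩, mem_graph_opMul.2 ⟨_, hD ψ, hS _⟩, rfl⟩)

theorem hasCommutativeTime_of_theta_eq_zero {Θ : Matrix (Fin n) (Fin n) ℝ}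
    (hΘ : ∀ μ : Fin n, Θ 0 μ = 0 ∧ Θ μ 0 = 0) (hγ : IsDiracMatrices γ) :
    (moyalMinkowski Θ γ).HasCommutativeTime := by
  refine ⟨mulOp timeWeight, ?_, ?_⟩
  · rw [time_eq_mulOp (funext fun μ => (hΘ μ).1)]
    exact isSqrtOneAddSq_timeWeight
  rintro A ⟨f, -, hA⟩
  -- The vanishing of column 0 puts the time direction in the kernel of `Θ`.
  have hker : ∀ k : ℝ, Matrix.toEuclideanLin Θ (k • timeVec) = 0 := fun k => by
    ext μ
    simp [timeVec, Matrix.toLpLin_apply, (hΘ μ).2]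
  have hpw : ∀ (k : ℝ) ψ, A (mulCLM (planeWaveBCF (k • timeVec)) ψ) =
      mulCLM (planeWaveBCF (k • timeVec)) (A ψ) := fun k => hA.commute_planeWave (hker k)
  refine ⟨commutesWith_mulOp_time hpw (hasTemperateGrowth_japanese _).1,
    CommutesWith.closure_of_bounded (fun x y => eq_commOp_of_mem_graph γ)
      (dense_domain_commutator γ) fun x => ?_⟩
  have h1 : A (mulCLM (ofTime japaneseDeriv) x) = mulCLM (ofTime japaneseDeriv) (A x) := by
    have h := commutesWith_iff.1 (commutesWith_mulOp_time hpw
      hasTemperateGrowth_mul_japanese.1) x (mulCLM (ofTime japaneseDeriv) x)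
      (mem_graph_mulOp.2 (coeFn_mulCLM _ x))
    exact Lp.ext ((mem_graph_mulOp.1 h).trans (coeFn_mulCLM (ofTime japaneseDeriv) (A x)).symm)
  -- Since γ⁰ squares to -1, its inverse is -γ⁰.
  have h2 := hA.commute_fibre (M := γ 0) (M' := -γ 0) (by rw [mul_neg, hγ.time_sq, neg_neg])
    (by rw [neg_mul, hγ.time_sq, neg_neg]) (mulCLM (ofTime japaneseDeriv) x)
  rw [h1] at h2
  change A (-Complex.I • fibreLp (γ 0) (mulCLM (ofTime japaneseDeriv) x)) =
    -Complex.I • fibreLp (γ 0) (mulCLM (ofTime japaneseDeriv) (A x))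
  rw [map_smul, h2]

end Sufficiency

/-! ### The equivalence -/

theorem mainTheorem4 (n : ℕ) [NeZero n] (Θ : Matrix (Fin n) (Fin n) ℝ) (hΘ : Θᵀ = -Θ)
    (γ : Fin n → Matrix (Fin (2 ^ (n / 2))) (Fin (2 ^ (n / 2))) ℂ) (hγ : IsDiracMatrices γ) :
    (moyalMinkowski Θ γ).HasCommutativeTime ↔ ∀ μ : Fin n, Θ 0 μ = 0 ∧ Θ μ 0 = 0 := by
  refine ⟨fun h μ => ?_, fun h => hasCommutativeTime_of_theta_eq_zero γ h hγ⟩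
  have h0 := theta_eq_zero_of_hasCommutativeTime hΘ h
  have h1 : Θ 0 μ = 0 := congrFun h0 μ
  have h2 : Θ 0 μ = -Θ μ 0 := congrFun (congrFun hΘ μ) 0
  exact ⟨h1, by linarith⟩
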